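/- **Definitions.** All graphs are finite and simple. A set $D$ of vertices of a graph $G$ is *dominating* if every vertex is in $D$ or has a neighbour in $D$. An instance of *TS-Dominating Set Reconfiguration* is $\mathcal A=(G,D_{\sf init},D_{\sf fin},k)$, where $D_{\sf init},D_{\sf fin}$ are dominating sets of size $k$ of the graph $G$. A *reconfiguration sequence of length $\ell$* for $\mathcal A$ is a sequence $D_{\sf init}=D_0,D_1,\dots,D_\ell=D_{\sf fin}$ of dominating sets of size $k$ such that each $D_{t+1}$ arises from $D_t$ by sliding one token along an edge to an empty vertex, i.e. $D_{t+1}=(D_t\setminus\{u\})\cup\{v\}$ with $u\in D_t$, $v\notin D_t$, $uv\in E(G)$. An instance of *Partitioned TS-Dominating Set Reconfiguration* additionally has a partition $P_1,\dots,P_k$ of $V(G)$ into token sets such that $D_{\sf init}$ and $D_{\sf fin}$ contain exactly one vertex of each $P_i$. In a reconfiguration sequence every $D_t$ must be a dominating set with exactly one vertex in each $P_i$, and a token may only slide along an edge to an empty vertex of the same token set. In both problems the question is whether a reconfiguration sequence (of any length) exists, and the parameter is the number $k$ of tokens. Instances are encoded as bit strings consisting of $|V(G)|$ and $k$ in unary,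 the adjacency matrix of $G$, the characteristic vectors of $D_{\sf init}$ and $D_{\sf fin}$ and, in the partitioned case, the incidence matrix of vertices and token sets. A *pl-reduction* (parameterized logspace reduction) is a map $f$ from the instances of one parameterized problem to those of another such that $\mathcal A$ is a yes-instance if and only if $f(\mathcal A)$ is one; the parameter of $f(\mathcal A)$ is at most $h(k)$ for a computable function $h$, where $k$ is the parameter of $\mathcal A$; and $f$ is computed by a deterministic Turing machine with read-only input tape and write-only output tape in work space $O(g(k)+\log n)$ for a computable function $g$, where $n$ is the number of bits of the input. **Lemma.** There is a pl-reduction $f$ from TS-Dominating Set Reconfiguration to Partitioned TS-Dominating Set Reconfiguration such that for every instance $\mathcal A$ of TS-Dominating Set Reconfiguration with $k$ tokens, $f(\mathcal A)$ has $k+2$ tokens, and for every $\ell\ge 0$, $\mathcal A$ admits a reconfiguration sequence of length at most $\ell$ if and only if $f(\mathcal A)$ admits a reconfiguration sequence of length at most $\ell+k+1$. Moreover, if $\mathcal A$ admits a reconfiguration sequence of length exactly $\ell$, then $f(\mathcal A)$ admits one of length exactly $\ell+k+1$; and if $f(\mathcal A)$ admits a reconfiguration sequence of length $m$, then $m\ge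 k+1$ and $\mathcal A$ admits one of length at most $m-(k+1)$. In particular, the length of a shortest reconfiguration sequence increases by exactly $k+1$. -/

import Mathlib

/-! ### Logarithmic-space transducers

A deterministic multi-tape Turing machine with a two-way read-only input tape, a fixed number of
two-way work tapes (infinite to the right) and a write-only one-way output tape. Only the work
tapes count towards the space. -/

/-- Head movements. -/
inductive HeadMove where
  | left
  | stay
  | right

/-- What the input head can read: a bit of the input, or one of the two end markers. -/
inductive InputSymbol where
  | leftEnd
  | bit (b : Bool)
  | rightEnd

/-- What the machine does in one step. -/
structure TransducerAction (Q Γ : Type) (t : ℕ) where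
  state : Q
  inputMove : HeadMove
  write : Fin t → Γ
  move : Fin t → HeadMove
  output : Option Bool

/-- A transducer; `trans` returns `none` exactly when the machine halts. -/
structure Transducer where
  Q : Type
  finQ : Fintype Q
  start : Q
  Γ : Type
  finΓ : Fintype Γ
  blank : Γ
  tapes : ℕ
  trans : Q → InputSymbol → (Fin tapes → Γ) → Option (TransducerAction Q Γ tapes)

namespace Transducer

/-- A configuration. The cells of every work tape are numbered `0, 1, 2, …`. -/
structure Cfg (M : Transducer) where
  state : M.Q
  inputPos : ℕ
  tape : Fin M.tapes → ℕ → M.Γ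
  head : Fin M.tapes → ℕ
  out : List Bool

/-- The input tape holds `leftEnd` in cell `0`, the bits of `x` in the cells `1, …, |x|`, and
`rightEnd` in cell `|x| + 1`. -/
def readInput (x : List Bool) : ℕ → InputSymbol
  | 0 => .leftEnd
  | p + 1 => if h : p < x.length then .bit x[p] else .rightEnd

/-- Moving the input head; it does not leave the cells `0, …, |x| + 1`. -/
def moveInput (x : List Bool) (p : ℕ) : HeadMove → ℕ
  | .left => p - 1
  | .stay => p
  | .right => min (p + 1) (x.length + 1)

/-- Moving a work head; a left move in cell `0` has no effect. -/
def moveWork (p : ℕ) : HeadMove → ℕ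
  | .left => p - 1
  | .stay => p
  | .right => p + 1

def init (M : Transducer) : M.Cfg where
  state := M.start
  inputPos := 0
  tape := fun _ _ => M.blank
  head := fun _ => 0
  out := []

def step (M : Transducer) (x : List Bool) (c : M.Cfg) : Option M.Cfg :=
  (M.trans c.state (readInput x c.inputPos) (fun i => c.tape i (c.head i))).map fun a =>
    { state := a.state
      inputPos := moveInput x c.inputPos a.inputMove
      tape := fun i => Function.update (c.tape i) (c.head i) (a.write i)
      head := fun i => moveWork (c.head i) (a.move i)
      out := c.out ++ a.output.toList }

/-- On input `x` the machine halts with output `y`, and throughout the run every work head stays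
within the first `s` cells of its tape. -/
def OutputsInSpace (M : Transducer) (x y : List Bool) (s : ℕ) : Prop :=
  (∃ c : M.Cfg, StateTransition.Reaches (M.step x) M.init c ∧ M.step x c = none ∧ c.out = y) ∧
  ∀ c : M.Cfg, StateTransition.Reaches (M.step x) M.init c → ∀ i, c.head i < s

end Transducer

/-! ### Parameterized problems and pl-reductions -/

/-- A parameterized decision problem: instances with a binary encoding, the parameter, and the
set of yes-instances. -/
structure ParamProblem where
  Inst : Type
  encode : Inst → List Bool
  encode_injective : Function.Injective encode
  param : Inst → ℕ
  IsYes : Inst → Prop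

/-- `f` is a parameterized logspace reduction (pl-reduction) from `P` to `P'`: it preserves the
answer, the new parameter is bounded by a computable function of the old one, and `f` is computed
by a deterministic transducer in space `O(g(k) + log n)` for some computable `g`, where `k` is the
parameter and `n` the number of bits of the input. -/
def IsPLReduction (P P' : ParamProblem) (f : P.Inst → P'.Inst) : Prop :=
  (∀ A, P.IsYes A ↔ P'.IsYes (f A)) ∧
  (∃ h : ℕ → ℕ, Computable h ∧ ∀ A, P'.param (f A) ≤ h (P.param A)) ∧
  ∃ (M : Transducer) (g : ℕ → ℕ) (c : ℕ), Computable g ∧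
    ∀ A, M.OutputsInSpace (P.encode A) (P'.encode (f A))
      (c * (g (P.param A) + Nat.log 2 (P.encode A).length + 1))

/-! ### Dominating set reconfiguration -/

/-- Every vertex is in `D` or has a neighbour in `D`. -/
def IsDominatingSet {V : Type} (G : SimpleGraph V) (D : Finset V) : Prop :=
  ∀ v, v ∈ D ∨ ∃ u ∈ D, G.Adj u v

/-- An instance `(G, D_init, D_fin, k)` of TS-Dominating Set Reconfiguration, the vertices of `G`
being `0, …, n - 1`. -/
structure TSDomInstance where
  n : ℕ
  k : ℕ
  G : SimpleGraph (Fin n)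
  Dinit : Finset (Fin n)
  Dfin : Finset (Fin n)
  init_dom : IsDominatingSet G Dinit
  fin_dom : IsDominatingSet G Dfin
  init_card : Dinit.card = k
  fin_card : Dfin.card = k

/-- The token on `u` slides along an edge to an empty vertex `v`, which turns `D` into `D'`. -/
def TokenSlide {n : ℕ} (G : SimpleGraph (Fin n)) (u v : Fin n) (D D' : Finset (Fin n)) : Prop :=
  u ∈ D ∧ v ∉ D ∧ G.Adj u v ∧ D' = insert v (D.erase u)

/-- There is a reconfiguration sequence `D_init = S 0, S 1, …, S ℓ = D_fin` of length `ℓ`: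
dominating sets of size `k`, each obtained from the previous one by a slide. -/
def TSDomInstance.AdmitsLength (A : TSDomInstance) (ℓ : ℕ) : Prop :=
  ∃ S : ℕ → Finset (Fin A.n), S 0 = A.Dinit ∧ S ℓ = A.Dfin ∧
    (∀ t ≤ ℓ, IsDominatingSet A.G (S t) ∧ (S t).card = A.k) ∧
    ∀ t < ℓ, ∃ u v, TokenSlide A.G u v (S t) (S (t + 1))

/-- `D` has exactly one vertex in each of the `k` token sets
`part ⁻¹' {i}`. -/
def OnePerTokenSet {n k : ℕ} (part : Fin n → Fin k) (D : Finset (Fin n)) : Prop :=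
  ∀ i, (D.filter fun v => part v = i).card = 1

/-- An instance of Partitioned TS-Dominating Set Reconfiguration: in addition, a partition of the
vertices into `k` token sets is given (`part v` is the index of the token set of `v`), and
`D_init` and `D_fin` have exactly one vertex in each token set. -/
structure PartTSDomInstance extends TSDomInstance where
  part : Fin n → Fin k
  init_part : OnePerTokenSet part Dinit
  fin_part : OnePerTokenSet part Dfin

/-- There is a reconfiguration sequence `D_init = S 0, S 1, …, S ℓ = D_fin` of length `ℓ`:
dominating sets with exactly one vertex in each token set, each obtained from the previous one by
a slide inside a token set. -/
def PartTSDomInstance.AdmitsLength (A : PartTSDomInstance) (ℓ : ℕ) : Prop :=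
  ∃ S : ℕ → Finset (Fin A.n), S 0 = A.Dinit ∧ S ℓ = A.Dfin ∧
    (∀ t ≤ ℓ, IsDominatingSet A.G (S t) ∧ OnePerTokenSet A.part (S t)) ∧
    ∀ t < ℓ, ∃ u v, A.part u = A.part v ∧ TokenSlide A.G u v (S t) (S (t + 1))

/-! ### Encodings -/

open Classical in
/-- `1ⁿ 0 1ᵏ 0`, followed by the adjacency matrix row by row and the characteristic vectors of
`D_init` and `D_fin`. -/
noncomputable def TSDomInstance.encode (A : TSDomInstance) : List Bool :=
  List.replicate A.n true ++ false :: (List.replicate A.k true ++ false ::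
    ((List.finRange A.n ×ˢ List.finRange A.n).map (fun p => decide (A.G.Adj p.1 p.2)) ++
      ((List.finRange A.n).map (fun v => decide (v ∈ A.Dinit)) ++
        (List.finRange A.n).map (fun v => decide (v ∈ A.Dfin)))))

/-- The encoding of the underlying instance, followed by the incidence matrix of vertices and
token sets, row by row (one row for each vertex). -/
noncomputable def PartTSDomInstance.encode (A : PartTSDomInstance) : List Bool :=
  A.toTSDomInstance.encode ++
    (List.finRange A.n ×ˢ List.finRange A.k).map (fun p => decide (A.part p.1 = p.2))

theorem replicate_true_append_inj {n m : ℕ} {l l' : List Bool}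
    (h : List.replicate n true ++ false :: l = List.replicate m true ++ false :: l') :
    n = m ∧ l = l' := by
  induction n generalizing m with
  | zero => cases m <;> simp_all [List.replicate_succ]
  | succ n ih =>
    cases m with
    | zero => simp [List.replicate_succ] at h
    | succ m =>
      simp only [List.replicate_succ, List.cons_append, List.cons.injEq, true_and] at h
      simpa using ih h

/-- Encodings determine instances, even when followed by further bits. -/
theorem TSDomInstance.encode_append_inj {A B : TSDomInstance} {l l' : List Bool}
    (h : A.encode ++ l = B.encode ++ l') : A = B ∧ l = l' := by
  obtain ⟨n, k, G, D, E, _, _, _, _⟩ := A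
  obtain ⟨n', k', G', D', E', _, _, _, _⟩ := B
  simp only [encode, List.append_assoc, List.cons_append] at h
  obtain ⟨rfl, h⟩ := replicate_true_append_inj h
  obtain ⟨rfl, h⟩ := replicate_true_append_inj h
  obtain ⟨h1, h⟩ := List.append_inj h (by simp)
  obtain ⟨h2, h⟩ := List.append_inj h (by simp)
  obtain ⟨h3, h⟩ := List.append_inj h (by simp)
  simp only [List.map_inj_left, decide_eq_decide] at h1 h2 h3
  refine ⟨?_, h⟩
  obtain rfl : G = G' := by
    ext u v
    exact h1 (u, v) (List.mem_product.2 ⟨List.mem_finRange u, List.mem_finRange v⟩)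
  obtain rfl : D = D' := Finset.ext fun v => h2 v (List.mem_finRange v)
  obtain rfl : E = E' := Finset.ext fun v => h3 v (List.mem_finRange v)
  rfl

theorem TSDomInstance.encode_injective : Function.Injective TSDomInstance.encode := by
  intro A B h
  exact (TSDomInstance.encode_append_inj (l := []) (l' := []) (by simpa using h)).1

theorem PartTSDomInstance.encode_injective : Function.Injective PartTSDomInstance.encode := by
  intro A B h
  obtain ⟨h1, h2⟩ := TSDomInstance.encode_append_inj h
  obtain ⟨A, p, _, _⟩ := A
  obtain ⟨B, q, _, _⟩ := B
  obtain rfl : A = B := h1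
  simp only [List.map_inj_left, decide_eq_decide] at h2
  obtain rfl : p = q := by
    funext u
    exact ((h2 (u, p u) (List.mem_product.2 ⟨List.mem_finRange _, List.mem_finRange _⟩)).1
      rfl).symm
  rfl

/-! ### The two problems, parameterized by the number of tokens -/

noncomputable def TSDomReconf : ParamProblem where
  Inst := TSDomInstance
  encode := TSDomInstance.encode
  encode_injective := TSDomInstance.encode_injective
  param := fun A => A.k
  IsYes := fun A => ∃ ℓ, A.AdmitsLength ℓ

noncomputable def PartTSDomReconf : ParamProblem where
  Inst := PartTSDomInstance
  encode := PartTSDomInstance.encode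
  encode_injective := PartTSDomInstance.encode_injective
  param := fun A => A.k
  IsYes := fun A => ∃ ℓ, A.AdmitsLength ℓ

/-! The new graph gives every token `i` its own copy `cp i (some u)` of each old vertex and a
parking place `cp i none`. One more token is a switch with two places. The last token is held on an
isolated vertex, the guardian, which every dominating set must contain. All other vertices (`dv`,
`park`, `sep`) are never occupied in a legal set; each of them imposes a condition on the other
tokens by having to be dominated.

While the switch is at `false`, these conditions say that no token is parked, that different tokens
stand on different old vertices, and that the vertices they occupy dominate the old graph. Slides in
this phase are exactly old slides, and every old slide lifts (`exists_newStep`,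
`oldStep_of_newStep`). While the switch is at `true`, they say only that every token is parked or
stands on a vertex of `A.Dfin` (`dominates_inConf_iff`). Hence the switch can be flipped only when
both sets of conditions hold: `k` distinct vertices, all in the `k`-element set `A.Dfin`, so the
occupied set is `A.Dfin`. The target has all tokens parked and the switch at `true`; it does not
record which token stood on which vertex of `A.Dfin`, so no assignment of tokens to final vertices
has to be fixed in advance.

A sequence of length `ℓ` is thus extended by one flip and `k` parking slides. Conversely, the part
of a new sequence before its first flip is an old sequence ending in `A.Dfin`. After that flip at
least `k` steps remain, because one step parks at most one token (`unparked_le_of_steps`). Whether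
the switch is flipped back later is irrelevant. This gives the shift by `k + 1`
(`exists_steps_of_oldSteps`, `exists_oldSteps`).

For the space bound, a small language of arithmetic expressions with bounded sums, and of programs
that emit bits in bounded loops, is compiled into transducers that hold each variable in binary on a
work tape of its own. All intermediate values are polynomial in the input length
(`Expr.cost_le_pow`), so logarithmic space suffices (`Prog.exists_transducer`). The vertices of the
new graph are numbered by explicit arithmetic formulas, which lets a single program `Prog.reduction`
write the encoding of the new instance (`denote_reduction`). -/

namespace LogSpace

open Function

/-! ### Counter programs as fragments of transducers -/

/-- Tape cells: blank, the left end marker, or a binary digit. -/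
abbrev Cell := Option (Option Bool)

/-- What a program does in one step: besides the input head it moves a single work head. -/
structure Act (S : Type) where
  state : S
  input : HeadMove
  write : Cell
  move : HeadMove
  output : Option Bool

def Act.map {S S' : Type} (f : S → S') (a : Act S) : Act S' :=
  ⟨f a.state, a.input, a.write, a.move, a.output⟩

/-- Configurations with a work tape for every natural number. -/
structure Conf (S : Type) where
  state : S
  pos : ℕ
  tape : ℕ → ℕ → Cell
  head : ℕ → ℕ
  out : List Bool

/-- In each state a code is halted or acts on one work tape. -/
abbrev Code (S : Type) := S → Option (ℕ × (InputSymbol → Cell → Act S))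

def Conf.next {S : Type} (x : List Bool) (c : Conf S) (r : ℕ) (a : Act S) : Conf S where
  state := a.state
  pos := Transducer.moveInput x c.pos a.input
  tape := update c.tape r (update (c.tape r) (c.head r) a.write)
  head := update c.head r (Transducer.moveWork (c.head r) a.move)
  out := c.out ++ a.output.toList

def Code.step {S : Type} (C : Code S) (x : List Bool) (c : Conf S) : Option (Conf S) :=
  (C c.state).map fun ra =>
    c.next x ra.1 (ra.2 (Transducer.readInput x c.pos) (c.tape ra.1 (c.head ra.1)))

/-- Reachability through configurations whose work heads stay in the cells `0, …, L`. -/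
def Reach {S : Type} (C : Code S) (x : List Bool) (L : ℕ) : Conf S → Conf S → Prop :=
  Relation.ReflTransGen fun c c' => C.step x c = some c' ∧ ∀ i, c'.head i ≤ L

/-- A program fragment with exits `E`. -/
structure Frag (E : Type) where
  Q : Type
  fin : Finite Q
  start : Q
  reg : Q → ℕ
  act : Q → InputSymbol → Cell → Act (Q ⊕ E)

/-- The code `C` contains the fragment `F`, its states being named by `φ` and its exits by `ψ`. -/
def Frag.Embeds {E S : Type} (F : Frag E) (C : Code S) (φ : F.Q → S) (ψ : E → S) : Prop :=
  ∀ q, C (φ q) = some (F.reg q, fun y g => (F.act q y g).map (Sum.elim φ ψ))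

/-- Contents of the counters, position of the input head and output. -/
structure Store where
  pos : ℕ
  reg : ℕ → ℕ
  out : List Bool

/-- The number with the given binary digits, least significant digit first. -/
def digitsVal : List Bool → ℕ
  | [] => 0
  | b :: w => b.toNat + 2 * digitsVal w

/-- The marker in cell 0 lets the head find its way back after each operation. Leading zeros in `w`
are permitted, so a decrement never has to shorten the tape contents. -/
def tapeOf (w : List Bool) : ℕ → Cell
  | 0 => some none
  | p + 1 => w[p]?.map some

/-- Configuration `c` in state `q` represents the store `σ`, with counters of at most `L` digits. -/
structure Rep {S : Type} (L : ℕ) (c : Conf S) (σ : Store) (q : S) : Prop where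
  state : c.state = q
  pos : c.pos = σ.pos
  out : c.out = σ.out
  head : ∀ i, c.head i = 0
  tape : ∀ i, ∃ w, c.tape i = tapeOf w ∧ digitsVal w = σ.reg i ∧ w.length ≤ L

/-- Started on the store `σ`, the fragment `F` leaves through exit `e` with store `σ'`, in the
space that suffices for counters up to `B`. -/
def Runs {E : Type} (F : Frag E) (x : List Bool) (B : ℕ) (σ : Store) (e : E) (σ' : Store) : Prop :=
  ∀ (S : Type) (C : Code S) (φ : F.Q → S) (ψ : E → S), F.Embeds C φ ψ →
    ∀ c, Rep (Nat.log 2 B + 1) c σ (φ F.start) →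
      ∃ c', Reach C x (Nat.log 2 B + 2) c c' ∧ Rep (Nat.log 2 B + 1) c' σ' (ψ e)

theorem Frag.Embeds.reach_of_next {E S : Type} {F : Frag E} {C : Code S} {φ : F.Q → S} {ψ : E → S}
    (h : F.Embeds C φ ψ) {x : List Bool} {L : ℕ} {c c' d : Conf S} (q : F.Q) (hq : c.state = φ q)
    (hc : c' = c.next x (F.reg q) ((F.act q (Transducer.readInput x c.pos)
      (c.tape (F.reg q) (c.head (F.reg q)))).map (Sum.elim φ ψ)))
    (hL : ∀ i, c'.head i ≤ L) (hd : Reach C x L c' d) : Reach C x L c d := by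
  refine Relation.ReflTransGen.head ⟨?_, hL⟩ hd
  simp only [Code.step, hq, h q, Option.map_some, hc]

/-! #### Basic fragments -/

/-- A single step that depends on the scanned input symbol and does not touch the work tapes. -/
def instr {E : Type} (f : InputSymbol → E) (m : HeadMove) (o : Option Bool) : Frag E where
  Q := Unit
  fin := inferInstance
  start := ()
  reg _ := 0
  act _ y g := ⟨Sum.inr (f y), m, g, .stay, o⟩

theorem runs_instr {E : Type} (f : InputSymbol → E) (m : HeadMove) (o : Option Bool)
    (x : List Bool) (B : ℕ) (σ : Store) :
    Runs (instr f m o) x B σ (f (Transducer.readInput x σ.pos))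
      ⟨Transducer.moveInput x σ.pos m, σ.reg, σ.out ++ o.toList⟩ := by
  intro S C φ ψ h c hc
  refine ⟨_, h.reach_of_next () hc.state rfl ?_ Relation.ReflTransGen.refl, ?_⟩
  · intro i
    by_cases hi : i = 0 <;> simp [Conf.next, update_apply, instr, Act.map, hc.head,
      Transducer.moveWork]
  · refine ⟨?_, ?_, ?_, ?_, ?_⟩
    · simp only [Conf.next, instr, Act.map, hc.pos]
      rfl
    · simp [Conf.next, instr, Act.map, hc.pos]
    · simp [Conf.next, instr, Act.map, hc.out]
    · intro i
      by_cases hi : i = 0 <;> simp [Conf.next, update_apply, instr, Act.map, hc.head,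
        Transducer.moveWork]
    · simpa [Conf.next, instr, Act.map] using hc.tape

/-- Flips digits from the least significant one up to the first one that differs from `b`. -/
def flipTo (b : Bool) : List Bool → List Bool
  | [] => [b]
  | d :: w => if d = b then (!b) :: flipTo b w else b :: w

theorem digitsVal_flipTo_true (w : List Bool) : digitsVal (flipTo true w) = digitsVal w + 1 := by
  induction w with
  | nil => rfl
  | cons d w ih => cases d <;> simp [flipTo, digitsVal, ih] <;> ring

theorem digitsVal_flipTo_false (w : List Bool) (h : digitsVal w ≠ 0) :
    digitsVal (flipTo false w) = digitsVal w - 1 := by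
  induction w with
  | nil => simp [digitsVal] at h
  | cons d w ih =>
    cases d
    · simp only [digitsVal, Bool.toNat_false] at h
      simp only [flipTo, digitsVal, Bool.not_false, Bool.toNat_true, if_true, Bool.toNat_false]
      rw [ih (by omega)]
      omega
    · simp [flipTo, digitsVal]

theorem length_flipTo_false (w : List Bool) (h : digitsVal w ≠ 0) :
    (flipTo false w).length = w.length := by
  induction w with
  | nil => simp [digitsVal] at h
  | cons d w ih =>
    cases d
    · simp only [digitsVal, Bool.toNat_false] at h
      simp [flipTo, ih (by omega)]
    · simp [flipTo]

/-- A new digit appears only when all digits were one, and then the new value is the power of two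
belonging to the old length. A bound on the value therefore bounds the length, even though leading
zeros are allowed. -/
theorem length_flipTo_true (w : List Bool) :
    (flipTo true w).length = w.length ∨
      (flipTo true w).length = w.length + 1 ∧ digitsVal (flipTo true w) = 2 ^ w.length := by
  induction w with
  | nil => simp [flipTo, digitsVal]
  | cons d w ih =>
    cases d
    · simp [flipTo]
    · rcases ih with h | ⟨h, h'⟩
      · simp [flipTo, h]
      · simp [flipTo, h, h', digitsVal, pow_succ, mul_comm]

theorem tapeOf_append_cons (p : List Bool) (d : Bool) (w : List Bool) :
    tapeOf (p ++ d :: w) (p.length + 1) = some (some d) := by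
  simp [tapeOf]

theorem update_tapeOf_append_cons (p : List Bool) (d d' : Bool) (w : List Bool) :
    update (tapeOf (p ++ d :: w)) (p.length + 1) (some (some d')) = tapeOf (p ++ d' :: w) := by
  funext i
  rcases i with _ | i
  · simp [tapeOf]
  · rcases lt_trichotomy i p.length with h | h | h
    · simp [tapeOf, h.ne, List.getElem?_append_left h]
    · simp [tapeOf, h]
    · simp only [tapeOf, update_apply, Nat.add_right_cancel_iff, h.ne', if_false]
      rw [List.getElem?_append_right h.le, List.getElem?_append_right h.le]
      obtain ⟨j, hj⟩ : ∃ j, i - p.length = j + 1 := ⟨i - p.length - 1, by omega⟩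
      simp [hj]

theorem update_tapeOf_append_nil (p : List Bool) (d : Bool) :
    update (tapeOf p) (p.length + 1) (some (some d)) = tapeOf (p ++ [d]) := by
  funext i
  rcases i with _ | i
  · simp [tapeOf]
  · rcases lt_trichotomy i p.length with h | h | h
    · simp [tapeOf, h.ne, List.getElem?_append_left h]
    · simp [tapeOf, h]
    · simp only [tapeOf, update_apply, Nat.add_right_cancel_iff, h.ne', if_false]
      rw [List.getElem?_eq_none (by omega), List.getElem?_eq_none (by simp; omega)]

/-- Increments (`b = true`) or decrements (`b = false`) counter `r`. -/
def carry (b : Bool) (r : ℕ) : Frag Unit where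
  Q := Option Bool
  fin := inferInstance
  start := none
  reg _ := r
  act q _ g := match q with
    | none => ⟨.inl (some false), .stay, g, .right, none⟩
    | some false =>
      if g = some (some b) then ⟨.inl (some false), .stay, some (some (!b)), .right, none⟩
      -- The scanned cell is either the opposite digit, which is flipped, or the first blank, where
      -- the number grows by a digit.
      else ⟨.inl (some true), .stay, some (some b), .left, none⟩
    | some true =>
      if g = some none then ⟨.inr (), .stay, g, .stay, none⟩
      else ⟨.inl (some true), .stay, g, .left, none⟩

/-- Tests whether counter `r` is nonzero. -/
def test (r : ℕ) : Frag Bool where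
  Q := Option (Option Bool)
  fin := inferInstance
  start := none
  reg _ := r
  act q _ g := match q with
    | none => ⟨.inl (some none), .stay, g, .right, none⟩
    | some none =>
      if g = some (some false) then ⟨.inl (some none), .stay, g, .right, none⟩
      else ⟨.inl (some (some g.isSome)), .stay, g, .left, none⟩
    | some (some b) =>
      if g = some none then ⟨.inr b, .stay, g, .stay, none⟩
      else ⟨.inl (some (some b)), .stay, g, .left, none⟩

theorem update_head_le {h : ℕ → ℕ} {L n : ℕ} (hL : ∀ i, h i ≤ L) (hn : n ≤ L) (r i : ℕ) :
    update h r n i ≤ L := by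
  by_cases hi : i = r <;> simp [hi, hL, hn]

/-- Moving the head of tape `r` back to the left end. -/
theorem Frag.Embeds.reach_rewind {E S : Type} {F : Frag E} {C : Code S} {φ : F.Q → S} {ψ : E → S}
    (h : F.Embeds C φ ψ) {x : List Bool} {L : ℕ} (q : F.Q) (e : E)
    (hq : ∀ y g, F.act q y g = if g = some none then ⟨.inr e, .stay, g, .stay, none⟩
      else ⟨.inl q, .stay, g, .left, none⟩)
    (w : List Bool) (n : ℕ) (c : Conf S) (hc : c.state = φ q) (hw : c.tape (F.reg q) = tapeOf w)
    (hn : c.head (F.reg q) = n) (hL : ∀ i, c.head i ≤ L) :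
    Reach C x L c ⟨ψ e, c.pos, c.tape, update c.head (F.reg q) 0, c.out⟩ := by
  induction n generalizing c with
  | zero =>
    refine h.reach_of_next q hc ?_ (update_head_le hL (Nat.zero_le _) _) Relation.ReflTransGen.refl
    simp [Conf.next, hq, hw, hn, tapeOf, Act.map, Transducer.moveInput, Transducer.moveWork]
  | succ n ih =>
    have hne : tapeOf w (n + 1) ≠ some none := by
      simp [tapeOf]
    have hb : ∀ i, update c.head (F.reg q) n i ≤ L :=
      update_head_le hL (by have := hL (F.reg q); omega) _
    have hnext : (c.next x (F.reg q) ((F.act q (Transducer.readInput x c.pos)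
        (c.tape (F.reg q) (c.head (F.reg q)))).map (Sum.elim φ ψ))) =
        ⟨φ q, c.pos, c.tape, update c.head (F.reg q) n, c.out⟩ := by
      simp [Conf.next, hq, hw, hn, hne, Act.map, Transducer.moveInput, Transducer.moveWork]
    refine h.reach_of_next q hc hnext.symm hb ?_
    simpa using ih ⟨φ q, c.pos, c.tape, update c.head (F.reg q) n, c.out⟩ rfl hw (by simp) hb

/-- The end of a carry: one write followed by the rewind. The hypothesis `hw'` covers both
overwriting a digit and appending one. -/
theorem carry_stop {S : Type} {C : Code S} {b : Bool} {r : ℕ} {φ : (carry b r).Q → S}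
    {ψ : Unit → S} (h : (carry b r).Embeds C φ ψ) {x : List Bool} {L : ℕ} (w w' : List Bool)
    (n : ℕ) (c : Conf S) (hc : c.state = φ (some false)) (hw : c.tape r = tapeOf w)
    (hn : c.head r = n + 1) (hL : ∀ i, c.head i ≤ L) (hne : tapeOf w (n + 1) ≠ some (some b))
    (hw' : update (tapeOf w) (n + 1) (some (some b)) = tapeOf w') :
    Reach C x L c ⟨ψ (), c.pos, update c.tape r (tapeOf w'), update c.head r 0, c.out⟩ := by
  have hnext : (c.next x r (((carry b r).act (some false) (Transducer.readInput x c.pos)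
        (c.tape r (c.head r))).map (Sum.elim φ ψ))) =
      ⟨φ (some true), c.pos, update c.tape r (tapeOf w'), update c.head r n, c.out⟩ := by
    simp [Conf.next, carry, hw, hn, hne, hw', Act.map, Transducer.moveInput, Transducer.moveWork]
    rfl
  have hb : ∀ i, (update c.head r n) i ≤ L :=
    update_head_le hL (by have := hL r; omega) _
  refine h.reach_of_next (some false) hc hnext.symm hb ?_
  have := h.reach_rewind (x := x) (L := L) (some true) () (fun _ _ => rfl) w' n
    ⟨φ (some true), c.pos, update c.tape r (tapeOf w'), update c.head r n, c.out⟩ rfl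
    (by simp [carry]) (by simp [carry]) hb
  simpa [carry] using this

/-- Here `p` holds the digits already flipped and `w` those still to be scanned; the induction moves
digits from `w` to `p`. -/
theorem carry_scan {S : Type} {C : Code S} {b : Bool} {r : ℕ} {φ : (carry b r).Q → S}
    {ψ : Unit → S} (h : (carry b r).Embeds C φ ψ) {x : List Bool} {L : ℕ} (w p : List Bool)
    (c : Conf S) (hc : c.state = φ (some false)) (hw : c.tape r = tapeOf (p ++ w))
    (hn : c.head r = p.length + 1) (hL : ∀ i, c.head i ≤ L)
    (hlen : (p ++ flipTo b w).length ≤ L) :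
    Reach C x L c ⟨ψ (), c.pos, update c.tape r (tapeOf (p ++ flipTo b w)),
      update c.head r 0, c.out⟩ := by
  induction w generalizing p c with
  | nil =>
    refine carry_stop h _ _ _ c hc hw hn hL ?_ ?_
    · simp [tapeOf]
    · simpa [flipTo] using update_tapeOf_append_nil p b
  | cons d w ih =>
    by_cases hd : d = b
    · have hnext : (c.next x r (((carry b r).act (some false) (Transducer.readInput x c.pos)
          (c.tape r (c.head r))).map (Sum.elim φ ψ))) =
          ⟨φ (some false), c.pos, update c.tape r (tapeOf (p ++ (!d) :: w)),
            update c.head r (p.length + 2), c.out⟩ := by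
        simp [Conf.next, carry, hw, hn, tapeOf_append_cons, Act.map, Transducer.moveInput,
          Transducer.moveWork, update_tapeOf_append_cons, hd]
        rfl
      have hlen' : p.length + (flipTo b w).length + 1 ≤ L := by
        simpa [flipTo, hd, add_assoc] using hlen
      have hpos : 0 < (flipTo b w).length := by
        cases w <;> simp [flipTo]
        split <;> simp
      have hb : ∀ i, (update c.head r (p.length + 2)) i ≤ L := update_head_le hL (by omega) _
      refine h.reach_of_next (some false) hc hnext.symm hb ?_
      have := ih (p ++ [!d])
        ⟨φ (some false), c.pos, update c.tape r (tapeOf (p ++ (!d) :: w)),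
            update c.head r (p.length + 2), c.out⟩ rfl (by simp) (by simp) hb
        (by simp; omega)
      simpa [flipTo, hd] using this
    · refine carry_stop h _ _ _ c hc hw hn hL ?_ ?_
      · simpa [tapeOf_append_cons] using hd
      · simpa [flipTo, hd] using update_tapeOf_append_cons p d b w

theorem runs_carry (b : Bool) (r : ℕ) (x : List Bool) (B : ℕ) (σ : Store) (v : ℕ)
    (hv : ∀ w, digitsVal w = σ.reg r → w.length ≤ Nat.log 2 B + 1 →
      digitsVal (flipTo b w) = v ∧ (flipTo b w).length ≤ Nat.log 2 B + 1) :
    Runs (carry b r) x B σ () ⟨σ.pos, update σ.reg r v, σ.out⟩ := by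
  intro S C φ ψ h c hc
  obtain ⟨w, hw, hval, hlen⟩ := hc.tape r
  obtain ⟨hval', hlen'⟩ := hv w hval hlen
  have hnext : (c.next x r (((carry b r).act none (Transducer.readInput x c.pos)
      (c.tape r (c.head r))).map (Sum.elim φ ψ))) =
      ⟨φ (some false), c.pos, c.tape, update c.head r 1, c.out⟩ := by
    simp [Conf.next, carry, hw, hc.head, Act.map, Transducer.moveInput, Transducer.moveWork]
    rfl
  have hb : ∀ i, (update c.head r 1) i ≤ Nat.log 2 B + 2 :=
    update_head_le (by simp [hc.head]) (by omega) _
  refine ⟨_, h.reach_of_next none hc.state hnext.symm hb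
    (carry_scan h w [] ⟨φ (some false), c.pos, c.tape, update c.head r 1, c.out⟩ rfl
      (by simpa using hw) (by simp) hb (by simp; omega)), rfl, hc.pos, hc.out, ?_, ?_⟩
  · intro i
    by_cases hi : i = r <;> simp [hi, hc.head]
  · intro i
    by_cases hi : i = r
    · subst hi
      exact ⟨flipTo b w, by simp, by simpa using hval', by simpa using hlen'⟩
    · simpa [hi] using hc.tape i

theorem runs_inc (r : ℕ) (x : List Bool) (B : ℕ) (σ : Store) (h : σ.reg r + 1 ≤ B) :
    Runs (carry true r) x B σ () ⟨σ.pos, update σ.reg r (σ.reg r + 1), σ.out⟩ := by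
  refine runs_carry _ _ _ _ _ _ fun w hw hlen => ?_
  rw [digitsVal_flipTo_true, hw]
  refine ⟨rfl, ?_⟩
  rcases length_flipTo_true w with h' | ⟨h', h''⟩
  · omega
  · rw [digitsVal_flipTo_true, hw] at h''
    have : w.length ≤ Nat.log 2 B := Nat.le_log_of_pow_le (by norm_num) (by omega)
    omega

theorem runs_dec (r : ℕ) (x : List Bool) (B : ℕ) (σ : Store) (h : σ.reg r ≠ 0) :
    Runs (carry false r) x B σ () ⟨σ.pos, update σ.reg r (σ.reg r - 1), σ.out⟩ := by
  refine runs_carry _ _ _ _ _ _ fun w hw hlen => ?_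
  rw [digitsVal_flipTo_false _ (by omega), hw, length_flipTo_false _ (by omega)]
  exact ⟨rfl, hlen⟩

/-- To the right of the marker, a cell that is not the digit zero is the digit one or blank, so
`g.isSome` tells whether a nonzero digit was found. -/
theorem test_stop {S : Type} {C : Code S} {r : ℕ} {φ : (test r).Q → S}
    {ψ : Bool → S} (h : (test r).Embeds C φ ψ) {x : List Bool} {L : ℕ} (w : List Bool) (n : ℕ)
    (c : Conf S) (hc : c.state = φ (some none)) (hw : c.tape r = tapeOf w)
    (hn : c.head r = n + 1) (hL : ∀ i, c.head i ≤ L) (g : Cell) (hg : tapeOf w (n + 1) = g)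
    (hne : g ≠ some (some false)) :
    Reach C x L c ⟨ψ g.isSome, c.pos, c.tape, update c.head r 0, c.out⟩ := by
  have hnext : (c.next x r (((test r).act (some none) (Transducer.readInput x c.pos)
        (c.tape r (c.head r))).map (Sum.elim φ ψ))) =
      ⟨φ (some (some g.isSome)), c.pos, c.tape, update c.head r n, c.out⟩ := by
    simp [Conf.next, test, hw, hn, hg, hne, Act.map, Transducer.moveInput, Transducer.moveWork]
    rfl
  have hb : ∀ i, (update c.head r n) i ≤ L :=
    update_head_le hL (by have := hL r; omega) _
  refine h.reach_of_next (some none) hc hnext.symm hb ?_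
  have := h.reach_rewind (x := x) (L := L) (some (some g.isSome)) g.isSome (fun _ _ => rfl) w n
    ⟨φ (some (some g.isSome)), c.pos, c.tape, update c.head r n, c.out⟩ rfl
    (by simpa [test] using hw) (by simp [test]) hb
  simpa [test] using this

theorem test_scan {S : Type} {C : Code S} {r : ℕ} {φ : (test r).Q → S}
    {ψ : Bool → S} (h : (test r).Embeds C φ ψ) {x : List Bool} {L : ℕ} (w p : List Bool)
    (c : Conf S) (hc : c.state = φ (some none)) (hw : c.tape r = tapeOf (p ++ w))
    (hn : c.head r = p.length + 1) (hL : ∀ i, c.head i ≤ L) (hlen : (p ++ w).length + 1 ≤ L) :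
    Reach C x L c ⟨ψ (decide (digitsVal w ≠ 0)), c.pos, c.tape, update c.head r 0, c.out⟩ := by
  induction w generalizing p c with
  | nil =>
    simpa [digitsVal] using
      test_stop h _ _ c hc hw hn hL none (by simp [tapeOf]) (by simp)
  | cons d w ih =>
    cases d
    · have hnext : (c.next x r (((test r).act (some none) (Transducer.readInput x c.pos)
          (c.tape r (c.head r))).map (Sum.elim φ ψ))) =
          ⟨φ (some none), c.pos, c.tape, update c.head r (p.length + 2), c.out⟩ := by
        simp [Conf.next, test, hw, hn, tapeOf_append_cons, Act.map, Transducer.moveInput,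
          Transducer.moveWork, update_tapeOf_append_cons]
        rfl
      have hb : ∀ i, (update c.head r (p.length + 2)) i ≤ L :=
        update_head_le hL (by simp at hlen; omega) _
      refine h.reach_of_next (some none) hc hnext.symm hb ?_
      have := ih (p ++ [false]) ⟨φ (some none), c.pos, c.tape, update c.head r (p.length + 2), c.out⟩
        rfl (by simpa using hw) (by simp) hb (by simpa using hlen)
      simpa [digitsVal] using this
    · simpa [digitsVal] using
        test_stop h _ _ c hc hw hn hL _ (tapeOf_append_cons p true w) (by simp)

theorem runs_test (r : ℕ) (x : List Bool) (B : ℕ) (σ : Store) :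
    Runs (test r) x B σ (decide (σ.reg r ≠ 0)) σ := by
  intro S C φ ψ h c hc
  obtain ⟨w, hw, hval, hlen⟩ := hc.tape r
  have hnext : (c.next x r (((test r).act none (Transducer.readInput x c.pos)
      (c.tape r (c.head r))).map (Sum.elim φ ψ))) =
      ⟨φ (some none), c.pos, c.tape, update c.head r 1, c.out⟩ := by
    simp [Conf.next, test, hw, hc.head, Act.map, Transducer.moveInput, Transducer.moveWork]
    rfl
  have hb : ∀ i, (update c.head r 1) i ≤ Nat.log 2 B + 2 :=
    update_head_le (by simp [hc.head]) (by omega) _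
  refine ⟨_, h.reach_of_next none hc.state hnext.symm hb
    (test_scan h w [] ⟨φ (some none), c.pos, c.tape, update c.head r 1, c.out⟩ rfl
      (by simpa using hw) (by simp) hb (by simp; omega)), ?_, hc.pos, hc.out, ?_, hc.tape⟩
  · simp [hval]
  · intro i
    by_cases hi : i = r <;> simp [hi, hc.head]

/-! #### Control structures -/

/-- Runs `F`, and then the fragment that belongs to the exit reached. -/
def Frag.bind {E E' : Type} [Finite E] (F : Frag E) (G : E → Frag E') : Frag E' where
  Q := F.Q ⊕ (Σ e, (G e).Q)
  fin := by
    have := F.fin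
    have := fun e => (G e).fin
    infer_instance
  start := .inl F.start
  reg := Sum.elim F.reg fun q => (G q.1).reg q.2
  act q y g := match q with
    | .inl q => (F.act q y g).map (Sum.elim (fun q => .inl (.inl q))
        fun e => .inl (.inr ⟨e, (G e).start⟩))
    | .inr ⟨e, q⟩ => ((G e).act q y g).map (Sum.elim (fun q => .inl (.inr ⟨e, q⟩)) .inr)

theorem Act.map_map {S S' S'' : Type} (f : S → S') (g : S' → S'') (a : Act S) :
    (a.map f).map g = a.map (g ∘ f) := rfl

/-- Exits are mere names, so naming the exit `e` of `F` by the start state of `G e` joins the two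
runs without an intermediate step. -/
theorem runs_bind {E E' : Type} [Finite E] {F : Frag E} {G : E → Frag E'} {x : List Bool} {B : ℕ}
    {σ σ' σ'' : Store} {e : E} {e' : E'} (h : Runs F x B σ e σ') (h' : Runs (G e) x B σ' e' σ'') :
    Runs (F.bind G) x B σ e' σ'' := by
  intro S C φ ψ hE c hc
  obtain ⟨c1, r1, hc1⟩ := h S C (fun q => φ (.inl q)) (fun e => φ (.inr ⟨e, (G e).start⟩))
    (fun q => by
      rw [hE (.inl q)]
      simp only [Frag.bind, Act.map_map, Sum.elim_inl]
      refine congrArg some (Prod.ext rfl (funext fun y => funext fun g =>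
        congrArg (fun f => Act.map f _) (funext fun z => ?_)))
      cases z <;> rfl) c hc
  obtain ⟨c2, r2, hc2⟩ := h' S C (fun q => φ (.inr ⟨e, q⟩)) ψ
    (fun q => by
      rw [hE (.inr ⟨e, q⟩)]
      simp only [Frag.bind, Act.map_map, Sum.elim_inr]
      refine congrArg some (Prod.ext rfl (funext fun y => funext fun g =>
        congrArg (fun f => Act.map f _) (funext fun z => ?_)))
      cases z <;> rfl) c1 hc1
  exact ⟨c2, r1.trans r2, hc2⟩

/-- Repeats `F` until it leaves through exit `false`. -/
def Frag.loop (F : Frag Bool) : Frag Unit where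
  Q := F.Q
  fin := F.fin
  start := F.start
  reg := F.reg
  act q y g := (F.act q y g).map
    (Sum.elim .inl fun b => if b then .inl F.start else .inr ())

theorem Frag.loop_embeds {F : Frag Bool} {S : Type} {C : Code S} {φ : F.Q → S} {ψ : Unit → S}
    (h : F.loop.Embeds C φ ψ) : F.Embeds C φ fun b => if b then φ F.start else ψ () := by
  intro q
  rw [h q]
  simp only [Frag.loop, Act.map_map]
  refine congrArg some (Prod.ext rfl (funext fun y => funext fun g =>
    congrArg (fun f => Act.map f _) (funext fun z => ?_)))
  rcases z with _ | _ | _ <;> rfl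

theorem runs_loop_false {F : Frag Bool} {x : List Bool} {B : ℕ} {σ σ' : Store}
    (h : Runs F x B σ false σ') : Runs F.loop x B σ () σ' :=
  fun S C φ _ hE c hc => h S C φ _ (Frag.loop_embeds hE) c hc

theorem runs_loop_true {F : Frag Bool} {x : List Bool} {B : ℕ} {σ σ' σ'' : Store}
    (h : Runs F x B σ true σ') (h' : Runs F.loop x B σ' () σ'') : Runs F.loop x B σ () σ'' := by
  intro S C φ ψ hE c hc
  obtain ⟨c1, r1, hc1⟩ := h S C φ _ (Frag.loop_embeds hE) c hc
  obtain ⟨c2, r2, hc2⟩ := h' S C φ ψ hE c1 hc1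
  exact ⟨c2, r1.trans r2, hc2⟩

end LogSpace

namespace LogSpace

open Function

/-! #### From fragments to transducers -/

def emptyStore : Store := ⟨0, fun _ => 0, []⟩

/-- The code that consists of a single fragment and halts at its exits. -/
def Frag.code {E : Type} (F : Frag E) : Code (F.Q ⊕ E)
  | .inl q => some (F.reg q, F.act q)
  | .inr _ => none

theorem Frag.embeds_code {E : Type} (F : Frag E) : F.Embeds F.code .inl .inr := by
  intro q
  refine congrArg some (Prod.ext rfl (funext fun y => funext fun g => ?_))
  simp [Act.map]

/-- A transducer with `T` work tapes that first marks the left ends of its work tapes and then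
runs `F`. -/
noncomputable def Frag.toTransducer {E : Type} [Finite E] (F : Frag E) (T : ℕ)
    (hT : ∀ q, F.reg q < T) : Transducer where
  Q := Option (F.Q ⊕ E)
  finQ :=
    have := F.fin
    Fintype.ofFinite _
  start := none
  Γ := Cell
  finΓ := inferInstance
  blank := none
  tapes := T
  trans q y g := match q with
    | none => some ⟨some (.inl F.start), .stay, fun _ => some none, fun _ => .stay, none⟩
    | some (.inl q) =>
      let a := F.act q y (g ⟨F.reg q, hT q⟩)
      some ⟨some a.state, a.input, update g ⟨F.reg q, hT q⟩ a.write,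
        update (fun _ => .stay) ⟨F.reg q, hT q⟩ a.move, a.output⟩
    | some (.inr _) => none

section

variable {E : Type} [Finite E] (F : Frag E) (T : ℕ) (hT : ∀ q, F.reg q < T)

/-- The configuration of the transducer that corresponds to a configuration of the code. -/
noncomputable def Frag.proj (c : Conf (F.Q ⊕ E)) : (F.toTransducer T hT).Cfg where
  state := some c.state
  inputPos := c.pos
  tape := fun i : Fin T => c.tape i
  head := fun i : Fin T => c.head i
  out := c.out

/-- By `hT` the fragment never acts on a tape numbered `T` or higher, so forgetting those tapes
commutes with a step. -/
theorem Frag.step_proj {x : List Bool} {c c' : Conf (F.Q ⊕ E)} (h : F.code.step x c = some c') :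
    (F.toTransducer T hT).step x (F.proj T hT c) = some (F.proj T hT c') := by
  obtain ⟨q, pos, tape, head, out⟩ := c
  cases q with
  | inr e => simp [Code.step, Frag.code] at h
  | inl q =>
    simp only [Code.step, Frag.code, Option.map_some, Option.some.injEq] at h
    subst h
    simp only [Transducer.step, Frag.proj, Frag.toTransducer, Option.map_some, Conf.next]
    congr 2
    · funext (i : Fin T)
      by_cases hi : i = ⟨F.reg q, hT q⟩
      · subst hi
        simp
      · have hi' : (i : ℕ) ≠ F.reg q := fun h => hi (Fin.ext h)
        simp [hi, hi']
    · funext (i : Fin T)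
      by_cases hi : i = ⟨F.reg q, hT q⟩
      · subst hi
        simp
      · have hi' : (i : ℕ) ≠ F.reg q := fun h => hi (Fin.ext h)
        simp [hi, hi', Transducer.moveWork]

theorem Frag.step_init (x : List Bool) :
    (F.toTransducer T hT).step x (F.toTransducer T hT).init =
      some (F.proj T hT ⟨.inl F.start, 0, fun _ => tapeOf [], fun _ => 0, []⟩) := by
  have : update (fun _ : ℕ => (none : Cell)) 0 (some none) = tapeOf [] := by
    funext i
    rcases i with _ | i <;> simp [tapeOf]
  simp only [Transducer.step, Frag.proj, Frag.toTransducer, Option.map_some, Transducer.init,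
    Transducer.moveInput, Transducer.moveWork, this]
  rfl

/-- The machine is deterministic and halts at `b`, so every reachable configuration lies on the one
known run, where the space bound was checked step by step. -/
theorem head_lt_of_reaches {M : Transducer} {x : List Bool} {s : ℕ} {a b : M.Cfg}
    (h : Relation.ReflTransGen (fun c c' => M.step x c = some c' ∧ ∀ i, c'.head i < s) a b)
    (hb : M.step x b = none) (ha : ∀ i, a.head i < s) {c : M.Cfg}
    (hc : StateTransition.Reaches (M.step x) a c) : ∀ i, c.head i < s := by
  induction h using Relation.ReflTransGen.head_induction_on with
  | refl =>
    rcases hc.cases_head with rfl | ⟨d, hd, -⟩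
    · exact ha
    · simp [hb] at hd
  | head h _ ih =>
    rcases hc.cases_head with rfl | ⟨d, hd, hdc⟩
    · exact ha
    · rw [h.1, Option.mem_some_iff] at hd
      exact ih h.2 (hd ▸ hdc)

theorem Frag.outputsInSpace {x : List Bool} {B : ℕ} {σ : Store} {e : E} {s : ℕ}
    (h : Runs F x B emptyStore e σ) (hs : Nat.log 2 B + 2 < s) :
    (F.toTransducer T hT).OutputsInSpace x σ.out s := by
  obtain ⟨c, hr, hc⟩ := h _ F.code .inl .inr F.embeds_code
    ⟨.inl F.start, 0, fun _ => tapeOf [], fun _ => 0, []⟩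
    ⟨rfl, rfl, rfl, fun _ => rfl, fun _ => ⟨[], rfl, rfl, by simp⟩⟩
  have hr' : Relation.ReflTransGen (fun c c' => (F.toTransducer T hT).step x c = some c' ∧
      ∀ i, c'.head i < s) (F.toTransducer T hT).init (F.proj T hT c) := by
    refine Relation.ReflTransGen.head ⟨F.step_init T hT x, fun i => ?_⟩
      (Relation.ReflTransGen.lift (F.proj T hT) (fun a b hab => ?_) _ _ hr)
    · simp only [Frag.proj]
      omega
    · exact ⟨F.step_proj T hT hab.1, fun i => (hab.2 _).trans_lt hs⟩
  have hhalt : (F.toTransducer T hT).step x (F.proj T hT c) = none := by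
    simp [Transducer.step, Frag.proj, Frag.toTransducer, hc.state]
  refine ⟨⟨_, Relation.ReflTransGen.mono (fun a b hab => hab.1) _ _ hr', hhalt, hc.out⟩, fun d hd =>
    head_lt_of_reaches hr' hhalt (fun i => ?_) hd⟩
  simp only [Transducer.init]
  omega

end

/-! ### Expressions and output programs -/

/-- Arithmetic expressions over the input bits. -/
inductive Expr where
  | var (i : ℕ)
  | one
  | add (a b : Expr)
  | mul (a b : Expr)
  | sub (a b : Expr)
  /-- `1` or `0` according to whether the input has bit `1` at position `e`. -/
  | bit (e : Expr)
  | len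
  /-- The sum of `e` over the values of variable `i` that are less than `b`. -/
  | sum (i : ℕ) (b e : Expr)

namespace Expr

def eval (x : List Bool) : Expr → (ℕ → ℕ) → ℕ
  | var i, ρ => ρ i
  | one, _ => 1
  | add a b, ρ => a.eval x ρ + b.eval x ρ
  | mul a b, ρ => a.eval x ρ * b.eval x ρ
  | sub a b, ρ => a.eval x ρ - b.eval x ρ
  | bit e, ρ => if x[e.eval x ρ]? = some true then 1 else 0
  | len, _ => x.length
  | sum i b e, ρ => ∑ j ∈ Finset.range (b.eval x ρ), e.eval x (update ρ i j)

/-- A bound for the numbers that occur in the evaluation. -/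
def cost (x : List Bool) : Expr → (ℕ → ℕ) → ℕ
  | var i, ρ => ρ i
  | one, _ => 1
  | add a b, ρ => a.cost x ρ + b.cost x ρ
  | mul a b, ρ => a.cost x ρ + a.eval x ρ * b.cost x ρ
  | sub a b, ρ => a.cost x ρ + b.cost x ρ
  | bit e, ρ => e.cost x ρ + 1
  | len, _ => x.length
  | sum i b e, ρ => b.cost x ρ + ρ i +
      ∑ j ∈ Finset.range (b.eval x ρ), e.cost x (update ρ i j)

/-- All variables of the expression are less than this number. -/
def fresh : Expr → ℕ
  | var i => i + 1
  | one => 0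
  | add a b => max a.fresh b.fresh
  | mul a b => max a.fresh b.fresh
  | sub a b => max a.fresh b.fresh
  | bit e => e.fresh
  | len => 0
  | sum i b e => max (i + 1) (max b.fresh e.fresh)

theorem eval_le_cost (x : List Bool) (e : Expr) (ρ : ℕ → ℕ) : e.eval x ρ ≤ e.cost x ρ := by
  induction e generalizing ρ with
  | var => rfl
  | one => rfl
  | len => rfl
  | add a b iha ihb => exact add_le_add (iha ρ) (ihb ρ)
  | mul a b iha ihb =>
    exact (Nat.mul_le_mul_left _ (ihb ρ)).trans (Nat.le_add_left _ _)
  | sub a b iha ihb =>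
    have := iha ρ
    simp only [eval, cost]
    omega
  | bit e ih =>
    simp only [eval, cost]
    split <;> omega
  | sum i b e ihb ihe =>
    exact (Finset.sum_le_sum fun j _ => ihe _).trans (Nat.le_add_left _ _)

/-- This makes values and costs insensitive to the target and scratch counters, which the compiler
takes at or above `e.fresh`. -/
theorem eval_cost_congr (x : List Bool) (e : Expr) {ρ ρ' : ℕ → ℕ}
    (h : ∀ i < e.fresh, ρ i = ρ' i) :
    e.eval x ρ = e.eval x ρ' ∧ e.cost x ρ = e.cost x ρ' := by
  induction e generalizing ρ ρ' with
  | var i => simpa [eval, cost, fresh] using h i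
  | one => simp [eval, cost]
  | len => simp [eval, cost]
  | add a b iha ihb | mul a b iha ihb | sub a b iha ihb =>
    simp only [fresh, lt_max_iff] at h
    simp only [eval, cost, iha fun i hi => h i (.inl hi), ihb fun i hi => h i (.inr hi),
      and_self]
  | bit e ih =>
    simp only [eval, cost, ih h, and_self]
  | sum i b e ihb ihe =>
    simp only [fresh, lt_max_iff] at h
    have hu : ∀ j, ∀ l < e.fresh, update ρ i j l = update ρ' i j l := by
      intro j l hl
      by_cases hli : l = i <;> simp [hli, h l (.inr (.inr hl))]
    simp only [eval, cost, ihb fun i hi => h i (.inr (.inl hi)), h i (.inl i.lt_succ_self),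
      fun j => ihe (hu j), and_self]

/-- The exponent depends only on the expression. Assuming `2 ≤ N` lets a constant factor be absorbed
by raising the exponent. -/
theorem cost_le_pow (e : Expr) : ∃ d, ∀ (x : List Bool) (ρ : ℕ → ℕ) (N : ℕ), 2 ≤ N →
    x.length ≤ N → (∀ i, ρ i ≤ N) → e.cost x ρ ≤ N ^ d := by
  induction e with
  | var i => exact ⟨1, fun x ρ N _ _ h => by simpa [cost] using h i⟩
  | one => exact ⟨0, fun x ρ N _ _ h => by simp [cost]⟩
  | len => exact ⟨1, fun x ρ N _ h _ => by simpa [cost] using h⟩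
  | add a b iha ihb | sub a b iha ihb =>
    obtain ⟨d, hd⟩ := iha
    obtain ⟨d', hd'⟩ := ihb
    refine ⟨max d d' + 1, fun x ρ N h2 hx h => ?_⟩
    have h1 := (hd x ρ N h2 hx h).trans (Nat.pow_le_pow_right (by omega) (le_max_left d d'))
    have h1' := (hd' x ρ N h2 hx h).trans (Nat.pow_le_pow_right (by omega) (le_max_right d d'))
    calc _ ≤ N ^ max d d' + N ^ max d d' := add_le_add h1 h1'
      _ = N ^ max d d' * 2 := by ring
      _ ≤ _ := Nat.mul_le_mul_left _ h2
  | mul a b iha ihb =>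
    obtain ⟨d, hd⟩ := iha
    obtain ⟨d', hd'⟩ := ihb
    refine ⟨d + d' + 1, fun x ρ N h2 hx h => ?_⟩
    have h1 := hd x ρ N h2 hx h
    have h1' := hd' x ρ N h2 hx h
    have h3 : 1 ≤ N ^ d' := Nat.one_le_pow _ _ (by omega)
    calc _ ≤ N ^ d * N ^ d' + N ^ d * N ^ d' := add_le_add (h1.trans (Nat.le_mul_of_pos_right _ h3))
          (Nat.mul_le_mul ((a.eval_le_cost x ρ).trans h1) h1')
      _ = N ^ (d + d') * 2 := by ring
      _ ≤ _ := Nat.mul_le_mul_left _ h2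
  | bit e ih =>
    obtain ⟨d, hd⟩ := ih
    refine ⟨d + 1, fun x ρ N h2 hx h => ?_⟩
    have h3 : 1 ≤ N ^ d := Nat.one_le_pow _ _ (by omega)
    calc _ ≤ N ^ d + N ^ d := add_le_add (hd x ρ N h2 hx h) h3
      _ = N ^ d * 2 := by ring
      _ ≤ _ := Nat.mul_le_mul_left _ h2
  | sum i b e ihb ihe =>
    obtain ⟨d, hd⟩ := ihb
    obtain ⟨d', hd'⟩ := ihe
    -- The summation variable runs up to `N ^ d`, so the summand is bounded with `N ^ (d + 1)` in
    -- place of `N`; the final `2` pays for adding three terms, as `3 ≤ N * N`.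
    refine ⟨d + 1 + (d + 1) * d' + 2, fun x ρ N h2 hx h => ?_⟩
    have hb := hd x ρ N h2 hx h
    have hN : N ≤ N ^ (d + 1) := Nat.le_self_pow (by omega) N
    have hb' : N ^ d ≤ N ^ (d + 1) := Nat.pow_le_pow_right (by omega) (by omega)
    have he : ∀ j ∈ Finset.range (b.eval x ρ),
        e.cost x (update ρ i j) ≤ (N ^ (d + 1)) ^ d' := by
      intro j hj
      have hj' := Finset.mem_range.1 hj
      have := b.eval_le_cost x ρ
      refine hd' x _ _ (h2.trans hN) (hx.trans hN) fun l => ?_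
      by_cases hl : l = i
      · simp only [hl, update_self]
        omega
      · simpa [hl] using (h l).trans hN
    have hs := Finset.sum_le_card_nsmul _ _ _ he
    rw [Finset.card_range, smul_eq_mul, ← pow_mul] at hs
    have hs' := hs.trans (Nat.mul_le_mul_right _ ((b.eval_le_cost x ρ).trans (hb.trans hb')))
    have h3 : 1 ≤ N ^ ((d + 1) * d') := Nat.one_le_pow _ _ (by omega)
    have h4 := Nat.le_mul_of_pos_right (N ^ (d + 1)) h3
    have h5 : 0 ≤ N ^ (d + 1) * N ^ ((d + 1) * d') := Nat.zero_le _
    calc _ ≤ N ^ (d + 1) * N ^ ((d + 1) * d') + N ^ (d + 1) * N ^ ((d + 1) * d')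
          + N ^ (d + 1) * N ^ ((d + 1) * d') :=
            add_le_add (add_le_add (by omega) (((h i).trans hN).trans h4)) hs'
      _ ≤ N ^ (d + 1) * N ^ ((d + 1) * d') * (2 * 2) := by omega
      _ ≤ N ^ (d + 1) * N ^ ((d + 1) * d') * (N * N) :=
        Nat.mul_le_mul_left _ (Nat.mul_le_mul h2 h2)
      _ = _ := by ring

end Expr

/-- Programs that write a string of bits. -/
inductive Prog where
  /-- Write the bit `1` if `e` is nonzero and the bit `0` otherwise. -/
  | emit (e : Expr)
  | seq (p q : Prog)
  /-- Run `p` for all values of variable `i` that are less than `b`. -/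
  | forEach (i : ℕ) (b : Expr) (p : Prog)

namespace Prog

def denote (x : List Bool) : Prog → (ℕ → ℕ) → List Bool
  | emit e, ρ => [decide (e.eval x ρ ≠ 0)]
  | seq p q, ρ => p.denote x ρ ++ q.denote x ρ
  | .forEach i b p, ρ => (List.range (b.eval x ρ)).flatMap fun j => p.denote x (update ρ i j)

/-- An expression whose cost and variables bound those of the program. -/
def toExpr : Prog → Expr
  | emit e => e
  | seq p q => p.toExpr.add q.toExpr
  | .forEach i b p => Expr.sum i b p.toExpr

end Prog

end LogSpace

namespace LogSpace

open Function

/-! ### Compiling expressions and programs -/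

def skip : Frag Unit := instr (fun _ => ()) .stay none

def Frag.seq {E : Type} (F : Frag Unit) (G : Frag E) : Frag E := F.bind fun _ => G

def ret (b : Bool) : Frag Bool := instr (fun _ => b) .stay none

/-- Runs `F` as often as the value of counter `r` tells, counting it down to zero. -/
def down (r : ℕ) (F : Frag Unit) : Frag Unit :=
  ((test r).bind fun b =>
    if b then (carry false r).seq (F.seq (ret true)) else ret false).loop

section

variable {x : List Bool} {B : ℕ}

theorem runs_skip (σ : Store) : Runs skip x B σ () σ := by
  simpa [skip, Transducer.moveInput] using runs_instr (fun _ => ()) .stay none x B σ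

theorem runs_ret (b : Bool) (σ : Store) : Runs (ret b) x B σ b σ := by
  simpa [ret, Transducer.moveInput] using runs_instr (fun _ => b) .stay none x B σ

theorem Runs.seq {E : Type} {F : Frag Unit} {G : Frag E} {σ σ' σ'' : Store} {e : E}
    (h : Runs F x B σ () σ') (h' : Runs G x B σ' e σ'') : Runs (F.seq G) x B σ e σ'' :=
  runs_bind h h'

/-- Here `f j` is the store after `j` rounds. Each round decrements `r` before it runs `F`, whence
the value `n - j - 1` seen by `F`. -/
theorem runs_down (r : ℕ) (F : Frag Unit) (n : ℕ) (f : ℕ → Store)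
    (hr : ∀ j ≤ n, (f j).reg r = n - j)
    (hF : ∀ j < n, Runs F x B ⟨(f j).pos, update (f j).reg r (n - j - 1), (f j).out⟩ ()
      (f (j + 1))) : Runs (down r F) x B (f 0) () (f n) := by
  induction n generalizing f with
  | zero =>
    refine runs_loop_false (runs_bind (runs_test r x B _) ?_)
    simpa [hr 0 le_rfl] using runs_ret false (f 0)
  | succ n ih =>
    refine runs_loop_true (σ' := f 1) (runs_bind (runs_test r x B _) ?_) ?_
    · have h0 := hr 0 (Nat.zero_le _)
      simp only [h0, Nat.sub_zero, ne_eq, Nat.succ_ne_zero, not_false_eq_true, decide_true, if_true]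
      refine (runs_dec r x B (f 0) (by omega)).seq (Runs.seq ?_ (runs_ret true _))
      simpa [h0] using hF 0 (Nat.succ_pos _)
    · refine ih (fun j => f (j + 1)) (fun j hj => ?_) fun j hj => ?_
      · rw [hr (j + 1) (by omega)]
        omega
      · have := hF (j + 1) (by omega)
        rwa [show n + 1 - (j + 1) - 1 = n - j - 1 by omega] at this

/-- Adding destroys the source; a value that is needed again must be moved elsewhere and brought
back. -/
theorem runs_add_to (r t : ℕ) (hrt : r ≠ t) (ρ : ℕ → ℕ) (p : ℕ) (o : List Bool)
    (hB : ρ t + ρ r ≤ B) :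
    Runs (down r (carry true t)) x B ⟨p, ρ, o⟩ ()
      ⟨p, update (update ρ t (ρ t + ρ r)) r 0, o⟩ := by
  have := runs_down (x := x) (B := B) r (carry true t) (ρ r)
    (fun j => ⟨p, update (update ρ t (ρ t + j)) r (ρ r - j), o⟩) (by simp) (fun j hj => by
      convert runs_inc t x B _ ?_ using 2
      · funext i
        simp only [update_apply]
        split_ifs <;> omega
      · simp [hrt.symm]
        omega)
  simpa using this

theorem runs_clear (r : ℕ) (ρ : ℕ → ℕ) (p : ℕ) (o : List Bool) :
    Runs (down r skip) x B ⟨p, ρ, o⟩ () ⟨p, update ρ r 0, o⟩ := by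
  have := runs_down (x := x) (B := B) r skip (ρ r)
    (fun j => ⟨p, update ρ r (ρ r - j), o⟩) (by simp) (fun j hj => by
      simpa [Nat.sub_sub] using runs_skip (x := x) (B := B) ⟨p, update ρ r (ρ r - (j + 1)), o⟩)
  simpa using this

/-- Runs `F` for all values of counter `i` that are less than the value of counter `s`; the
counter `i` is restored. -/
def forLoop (i s : ℕ) (F : Frag Unit) : Frag Unit :=
  (down i (carry true (s + 1))).seq ((down s (F.seq (carry true i))).seq
    ((down i skip).seq (down (s + 1) (carry true i))))

/-- During round `j` counter `i` holds `j`, counter `s` the number of rounds still to come, and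
counter `s + 1` the saved old value of `i`. The body turns `ρ j` into `ρ (j + 1)` and must preserve
these three. -/
theorem runs_forLoop (i s : ℕ) (his : i < s) (F : Frag Unit) (n : ℕ) (ρ : ℕ → ℕ → ℕ)
    (o : ℕ → List Bool) (hs : ∀ j, ρ j s = 0) (hs' : ∀ j, ρ j (s + 1) = 0)
    (hi : ∀ j, ρ j i = ρ 0 i) (hn : n ≤ B) (hiB : ρ 0 i ≤ B)
    (hF : ∀ j < n, Runs F x B
      ⟨0, update (update (update (ρ j) i j) s (n - j - 1)) (s + 1) (ρ 0 i), o j⟩ ()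
      ⟨0, update (update (update (ρ (j + 1)) i j) s (n - j - 1)) (s + 1) (ρ 0 i), o (j + 1)⟩) :
    Runs (forLoop i s F) x B ⟨0, update (ρ 0) s n, o 0⟩ () ⟨0, ρ n, o n⟩ := by
  refine (runs_add_to i (s + 1) (by omega) _ _ _ ?_).seq ?_
  · simpa [show i ≠ s by omega, hs'] using hiB
  refine Runs.seq (σ' := ⟨0, update (update (update (ρ n) i n) s 0) (s + 1) (ρ 0 i), o n⟩) ?_
    ((runs_clear i _ _ _).seq ?_)
  · have := runs_down (x := x) (B := B) s (F.seq (carry true i)) n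
      (fun j => ⟨0, update (update (update (ρ j) i j) s (n - j)) (s + 1) (ρ 0 i), o j⟩)
      (fun j hj => by simp) (fun j hj => by
        refine Runs.seq (σ' := ?_) ?_ (?_ : Runs _ x B _ _ _)
        rotate_left
        · convert hF j hj using 2
          funext l
          simp only [update_apply]
          split_ifs <;> omega
        · convert runs_inc i x B _ ?_ using 2
          · funext l
            simp only [update_apply]
            split_ifs <;> omega
          · simp [show i ≠ s by omega, show i ≠ s + 1 by omega]
            omega)
    convert this using 2
    · funext l
      have := hs' 0
      simp only [update_apply]
      split_ifs <;> omega
    · simp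
  · convert runs_add_to (x := x) (B := B) (s + 1) i (by omega) _ _ _ ?_ using 2
    · funext l
      have h1 := hs n
      have h2 := hs' n
      have h3 := hi n
      simp only [update_apply]
      split_ifs <;> first | omega | simp_all
    · simpa [show i ≠ s + 1 by omega, show s + 1 ≠ i by omega] using hiB

/-! #### The input head -/

def rewind : Frag Unit :=
  ((instr (fun y => match y with | .leftEnd => false | _ => true) .stay none).bind fun b =>
    if b then (instr (fun _ => true) .left none) else ret false).loop

def readBit (t : ℕ) : Frag Unit :=
  ((instr (fun y => match y with | .bit true => true | _ => false) .stay none).bind fun b =>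
    if b then carry true t else skip).seq rewind

def moveRight : Frag Unit := instr (fun _ => ()) .right none

def inputLength (t : ℕ) : Frag Unit :=
  moveRight.seq (((instr (fun y => match y with | .rightEnd => false | _ => true) .stay none).bind
    fun b => if b then (carry true t).seq (moveRight.seq (ret true)) else ret false).loop.seq
      rewind)

theorem runs_rewind (p : ℕ) (ρ : ℕ → ℕ) (o : List Bool) :
    Runs rewind x B ⟨p, ρ, o⟩ () ⟨0, ρ, o⟩ := by
  induction p with
  | zero =>
    refine runs_loop_false (runs_bind (runs_instr _ _ _ _ _ _) ?_)
    simpa [Transducer.readInput, Transducer.moveInput] using runs_ret false _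
  | succ p ih =>
    refine runs_loop_true (runs_bind (runs_instr _ _ _ _ _ _) ?_) ih
    have := runs_instr (fun _ => true) .left none x B ⟨p + 1, ρ, o⟩
    by_cases hp : p < x.length <;>
      simpa [Transducer.readInput, Transducer.moveInput, hp] using this

theorem runs_moveRight (p : ℕ) (ρ : ℕ → ℕ) (o : List Bool) :
    Runs moveRight x B ⟨p, ρ, o⟩ () ⟨min (p + 1) (x.length + 1), ρ, o⟩ := by
  simpa [moveRight, Transducer.moveInput] using runs_instr (fun _ => ()) .right none x B ⟨p, ρ, o⟩

/-- Bit `p` lies in cell `p + 1` because of the left end marker. A head sent beyond the input stays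
on the right end marker, which counts as a zero bit, in agreement with `Expr.eval`. -/
theorem runs_readBit (t p : ℕ) (ρ : ℕ → ℕ) (o : List Bool) (hB : ρ t + 1 ≤ B) :
    Runs (readBit t) x B ⟨min (p + 1) (x.length + 1), ρ, o⟩ ()
      ⟨0, update ρ t (ρ t + if x[p]? = some true then 1 else 0), o⟩ := by
  refine Runs.seq (runs_bind (runs_instr _ _ _ _ _ _) ?_)
    (runs_rewind (min (p + 1) (x.length + 1)) _ _)
  have hr : Transducer.readInput x (min (p + 1) (x.length + 1)) =
      if h : p < x.length then .bit x[p] else .rightEnd := by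
    rcases lt_or_ge p x.length with h | h
    · rw [min_eq_left (by omega)]
      rfl
    · rw [min_eq_right (by omega)]
      simp [Transducer.readInput, h.not_gt]
  simp only [hr]
  by_cases hp : p < x.length
  · cases hb : x[p]
    · simpa [hp, hb, Transducer.moveInput] using runs_skip _
    · simpa [hp, hb, Transducer.moveInput] using runs_inc t x B ⟨_, ρ, o⟩ hB
  · simpa [hp, Transducer.moveInput] using runs_skip _

theorem runs_inputLength (t : ℕ) (ρ : ℕ → ℕ) (o : List Bool) (hB : ρ t + x.length ≤ B) :
    Runs (inputLength t) x B ⟨0, ρ, o⟩ () ⟨0, update ρ t (ρ t + x.length), o⟩ := by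
  refine (runs_moveRight _ _ _).seq (Runs.seq ?_ (runs_rewind (x.length + 1) _ _))
  have key : ∀ n p : ℕ, p + n = x.length → Runs (((instr (fun y => match y with
        | .rightEnd => false | _ => true) .stay none).bind
      fun b => if b then (carry true t).seq (moveRight.seq (ret true)) else ret false).loop) x B
      ⟨p + 1, update ρ t (ρ t + p), o⟩ () ⟨x.length + 1, update ρ t (ρ t + x.length), o⟩ := by
    intro n
    induction n with
    | zero =>
      rintro p rfl
      refine runs_loop_false (runs_bind (runs_instr _ _ _ _ _ _) ?_)
      simpa [Transducer.readInput, Transducer.moveInput] using runs_ret false _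
    | succ n ih =>
      intro p hp
      refine runs_loop_true (runs_bind (runs_instr _ _ _ _ _ _) ?_) (ih (p + 1) (by omega))
      have hpx : p < x.length := by omega
      have h1 := runs_inc t x B ⟨p + 1, update ρ t (ρ t + p), o⟩ (by simp; omega)
      have h2 := runs_moveRight (x := x) (B := B) (p + 1) (update ρ t (ρ t + (p + 1))) o
      rw [min_eq_left (by omega)] at h2
      have h3 := (Runs.seq (by simpa [add_assoc] using h1) (h2.seq (runs_ret true _)))
      simpa [Transducer.readInput, Transducer.moveInput, hpx] using h3
  simpa using key x.length 0 (by simp)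

end

end LogSpace

namespace LogSpace

open Function

namespace Expr

/-- Adds the value of the expression to counter `t`, by means of the counters `s, s + 1, …`. -/
def compile : Expr → ℕ → ℕ → Frag Unit
  | var i, t, s => (down i ((carry true t).seq (carry true s))).seq (down s (carry true i))
  | one, t, _ => carry true t
  | add a b, t, s => (a.compile t s).seq (b.compile t s)
  | mul a b, t, s => (a.compile s (s + 1)).seq (down s (b.compile t (s + 1)))
  | sub a b, t, s => (a.compile s (s + 2)).seq ((b.compile (s + 1) (s + 2)).seq
      ((down (s + 1) ((test s).bind fun c => if c then carry false s else skip)).seq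
        (down s (carry true t))))
  | bit e, t, s => (e.compile s (s + 1)).seq (moveRight.seq ((down s moveRight).seq (readBit t)))
  | len, t, _ => inputLength t
  | sum i b e, t, s => (b.compile s (s + 2)).seq (forLoop i s (e.compile t (s + 2)))

/-- The invariant that makes compilation compositional: scratch counters from `s` on are zero before
and after, only `t` changes, and the input head returns to cell 0. -/
theorem runs_compile {x : List Bool} {B : ℕ} (e : Expr) (t s : ℕ) (ρ : ℕ → ℕ) (o : List Bool)
    (het : e.fresh ≤ t) (hts : t < s) (hz : ∀ j, s ≤ j → ρ j = 0)
    (hB : ρ t + e.cost x ρ ≤ B) :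
    Runs (e.compile t s) x B ⟨0, ρ, o⟩ () ⟨0, update ρ t (ρ t + e.eval x ρ), o⟩ := by
  induction e generalizing t s ρ with
  | var i =>
    simp only [fresh, cost] at het hB
    have hs := hz s le_rfl
    refine Runs.seq (σ' := ⟨0, update (update (update ρ t (ρ t + ρ i)) s (ρ i)) i 0, o⟩) ?_ ?_
    · have := runs_down (x := x) (B := B) i ((carry true t).seq (carry true s)) (ρ i)
        (fun j => ⟨0, update (update (update ρ t (ρ t + j)) s j) i (ρ i - j), o⟩) (by simp)
        (fun j hj => by
          refine Runs.seq (runs_inc t x B _ ?_) ?_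
          · simp [show t ≠ i by omega, show t ≠ s by omega]
            omega
          · convert runs_inc s x B _ ?_ using 2
            · funext l
              simp only [update_apply]
              split_ifs <;> omega
            · simp [show s ≠ i by omega, show s ≠ t by omega]
              omega)
      convert this using 2
      · funext l
        simp only [update_apply]
        split_ifs <;> simp_all
      · simp
    · convert runs_add_to (x := x) (B := B) s i (by omega) _ _ _ ?_ using 2
      · funext l
        simp only [update_apply, eval]
        split_ifs <;> first | omega | simp_all
      · simp [show s ≠ i by omega]
        omega
  | one => exact runs_inc t x B ⟨0, ρ, o⟩ hB
  | len => exact runs_inputLength t ρ o hB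
  | add a b iha ihb =>
    simp only [fresh, cost, max_le_iff] at het hB
    have ha := a.eval_le_cost x ρ
    have hb := b.eval_cost_congr x (ρ := update ρ t (ρ t + a.eval x ρ)) (ρ' := ρ)
      (fun l hl => by simp [show l ≠ t by omega])
    have := (iha t s ρ het.1 hts hz (by omega)).seq (ihb t s (update ρ t (ρ t + a.eval x ρ)) het.2
      hts (fun j hj => by simp [show j ≠ t by omega, hz j hj]) (by simp [hb.2]; omega))
    simpa [compile, hb.1, eval, add_assoc] using this
  | mul a b iha ihb =>
    simp only [fresh, cost, max_le_iff] at het hB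
    have hs := hz s le_rfl
    have h1 := iha s (s + 1) ρ (by omega) (by omega) (fun j hj => hz j (by omega)) (by omega)
    refine h1.seq ?_
    have := runs_down (x := x) (B := B) s (b.compile t (s + 1)) (a.eval x ρ)
      (fun j => ⟨0, update (update ρ t (ρ t + j * b.eval x ρ)) s (a.eval x ρ - j), o⟩) (by simp)
      (fun j hj => by
        have hb := b.eval_cost_congr x (ρ := update (update (update ρ t (ρ t + j * b.eval x ρ)) s
          (a.eval x ρ - j)) s (a.eval x ρ - j - 1)) (ρ' := ρ)
          (fun l hl => by simp [show l ≠ t by omega, show l ≠ s by omega])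
        convert ihb t (s + 1) _ (by omega) (by omega) (fun l hl => ?_) ?_ using 2
        · funext l
          rw [hb.1]
          have : (j + 1) * b.eval x ρ = j * b.eval x ρ + b.eval x ρ := by ring
          simp only [update_apply]
          split_ifs <;> omega
        · simp [show l ≠ t by omega, show l ≠ s by omega, hz l (by omega)]
        -- The `j` copies of the value of `b` already added and the cost of evaluating `b` once more
        -- amount to at most `j + 1` times that cost.
        · have h2 : (j + 1) * b.cost x ρ ≤ a.eval x ρ * b.cost x ρ := Nat.mul_le_mul_right _ hj
          have h3 := Nat.mul_le_mul_left j (b.eval_le_cost x ρ)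
          rw [hb.2]
          simp [show t ≠ s by omega]
          linarith)
    convert this using 2
    · simp [hs]
    · funext l
      simp only [update_apply, eval]
      split_ifs <;> first | omega | simp_all
  | sub a b iha ihb =>
    simp only [fresh, cost, max_le_iff] at het hB
    have hs := hz s le_rfl
    have hs' := hz (s + 1) (by omega)
    have ha := a.eval_le_cost x ρ
    refine (iha s (s + 2) ρ (by omega) (by omega) (fun j hj => hz j (by omega)) (by omega)).seq ?_
    have hb := b.eval_cost_congr x (ρ := update ρ s (ρ s + a.eval x ρ)) (ρ' := ρ)
      (fun l hl => by simp [show l ≠ s by omega])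
    refine (ihb (s + 1) (s + 2) _ (by omega) (by omega)
      (fun j hj => by simp [show j ≠ s by omega, hz j (by omega)])
      (by simp [hb.2, hs']; omega)).seq ?_
    rw [hb.1]
    refine Runs.seq (σ' := ⟨0, update ρ s (a.eval x ρ - b.eval x ρ), o⟩) ?_ ?_
    · have := runs_down (x := x) (B := B) (s + 1)
        ((test s).bind fun c => if c then carry false s else skip) (b.eval x ρ)
        (fun j => ⟨0, update (update ρ s (a.eval x ρ - j)) (s + 1) (b.eval x ρ - j), o⟩) (by simp)
        (fun j hj => by
          refine runs_bind (runs_test _ _ _ _) ?_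
          by_cases h : a.eval x ρ - j = 0
          · simp only [ne_eq, not_false_eq_true, update_of_ne, h,
              show s ≠ s + 1 by omega, update_self, not_true_eq_false, decide_false]
            convert runs_skip _ using 2
            · simp
            · funext l
              simp only [update_apply]
              split_ifs <;> omega
          · simp only [ne_eq, not_false_eq_true, update_of_ne, h,
              show s ≠ s + 1 by omega, update_self, decide_true, if_true]
            convert runs_dec s x B _ ?_ using 2
            · funext l
              simp only [update_apply]
              split_ifs <;> omega
            · simpa using h)
      convert this using 2
      · simp [hs, hs']
      · funext l
        simp only [update_apply]
        split_ifs <;> simp_all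
    · convert runs_add_to (x := x) (B := B) s t (by omega) _ _ _ ?_ using 2
      · funext l
        simp only [update_apply, eval]
        split_ifs <;> first | omega | simp_all
      · simp [show t ≠ s by omega]
        omega
  | bit e ih =>
    simp only [fresh, cost] at het hB
    have hs := hz s le_rfl
    refine (ih s (s + 1) ρ (by omega) (by omega) (fun j hj => hz j (by omega)) (by omega)).seq
      ((runs_moveRight 0 _ _).seq (Runs.seq ?_ (runs_readBit t (e.eval x ρ) ρ o (by omega))))
    have := runs_down (x := x) (B := B) s moveRight (e.eval x ρ)
      (fun j => ⟨min (j + 1) (x.length + 1), update ρ s (e.eval x ρ - j), o⟩) (by simp)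
      (fun j hj => by
        convert runs_moveRight _ _ _ using 2
        · change min (j + 1 + 1) _ = min (min (j + 1) _ + 1) _
          omega
        · simp [Nat.sub_sub])
    convert this using 2
    · simp [hs]
    · rw [Nat.sub_self, ← hs, update_eq_self]
  | sum i b e ihb ihe =>
    simp only [fresh, cost, max_le_iff] at het hB
    have hs := hz s le_rfl
    have hs' := hz (s + 1) (by omega)
    have hb := b.eval_le_cost x ρ
    refine (ihb s (s + 2) ρ (by omega) (by omega) (fun j hj => hz j (by omega)) (by omega)).seq ?_
    have hit : i ≠ t := by omega
    have := runs_forLoop (x := x) (B := B) i s (by omega) (e.compile t (s + 2)) (b.eval x ρ)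
      (fun j => update ρ t (ρ t + ∑ l ∈ Finset.range j, e.eval x (update ρ i l))) (fun _ => o)
      (fun j => by simp [show s ≠ t by omega, hs])
      (fun j => by simp [show s + 1 ≠ t by omega, hs'])
      (fun j => by simp [hit]) (by omega) (by simp [hit]; omega)
      (fun j hj => by
        have he := e.eval_cost_congr x (ρ := update (update (update (update ρ t
          (ρ t + ∑ l ∈ Finset.range j, e.eval x (update ρ i l))) i j) s (b.eval x ρ - j - 1))
          (s + 1) (update ρ t (ρ t + ∑ l ∈ Finset.range 0, e.eval x (update ρ i l)) i))
          (ρ' := update ρ i j)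
          (fun l hl => by
            by_cases hli : l = i <;>
              simp [hli, show l ≠ t by omega, show l ≠ s by omega, show l ≠ s + 1 by omega,
                show i ≠ s by omega, show i ≠ s + 1 by omega])
        convert ihe t (s + 2) _ (by omega) (by omega) (fun l hl => ?_) ?_ using 2
        · rw [he.1]
          funext l
          rw [Finset.sum_range_succ]
          simp only [update_apply]
          split_ifs <;> omega
        · simp [show l ≠ t by omega, show l ≠ s by omega, show l ≠ s + 1 by omega,
            show l ≠ i by omega, hz l (by omega)]
        · rw [he.2]
          have h1 : ∑ l ∈ Finset.range j, e.eval x (update ρ i l) ≤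
            ∑ l ∈ Finset.range j, e.cost x (update ρ i l) :=
            Finset.sum_le_sum fun l _ => e.eval_le_cost x _
          have h2 : ∑ l ∈ Finset.range (j + 1), e.cost x (update ρ i l) ≤
            ∑ l ∈ Finset.range (b.eval x ρ), e.cost x (update ρ i l) :=
            Finset.sum_le_sum_of_subset (Finset.range_subset_range.2 hj)
          rw [Finset.sum_range_succ] at h2
          simp [show t ≠ s by omega, show t ≠ s + 1 by omega, hit.symm]
          omega)
    convert this using 2
    · simp [hs]
    · rfl

end Expr

/-! ### Compiling output programs and bounding their space -/

namespace Prog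

def compile : Prog → ℕ → Frag Unit
  | emit e, s => (e.compile s (s + 1)).seq ((test s).bind fun b =>
      (instr (fun _ => ()) .stay (some b)).seq (down s skip))
  | seq p q, s => (p.compile s).seq (q.compile s)
  | .forEach i b p, s => (b.compile s (s + 2)).seq (forLoop i s (p.compile (s + 2)))

theorem denote_congr (x : List Bool) (p : Prog) {ρ ρ' : ℕ → ℕ}
    (h : ∀ i < p.toExpr.fresh, ρ i = ρ' i) : p.denote x ρ = p.denote x ρ' := by
  induction p generalizing ρ ρ' with
  | emit e => simp only [denote, (e.eval_cost_congr x h).1]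
  | seq p q ihp ihq =>
    simp only [toExpr, Expr.fresh, lt_max_iff] at h
    simp only [denote, ihp fun i hi => h i (.inl hi), ihq fun i hi => h i (.inr hi)]
  | forEach i b p ih =>
    simp only [toExpr, Expr.fresh, lt_max_iff] at h
    have hu : ∀ j, ∀ l < p.toExpr.fresh, update ρ i j l = update ρ' i j l := by
      intro j l hl
      by_cases hli : l = i <;> simp [hli, h l (.inr (.inr hl))]
    simp only [denote, (b.eval_cost_congr x fun i hi => h i (.inr (.inl hi))).1, fun j => ih (hu j)]

theorem runs_compile {x : List Bool} {B : ℕ} (p : Prog) (s : ℕ) (ρ : ℕ → ℕ) (o : List Bool)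
    (hs : p.toExpr.fresh ≤ s) (hz : ∀ j, s ≤ j → ρ j = 0) (hB : p.toExpr.cost x ρ ≤ B) :
    Runs (p.compile s) x B ⟨0, ρ, o⟩ () ⟨0, ρ, o ++ p.denote x ρ⟩ := by
  induction p generalizing s ρ o with
  | emit e =>
    have h0 := hz s le_rfl
    simp only [toExpr] at hs hB
    refine (e.runs_compile s (s + 1) ρ o hs (by omega) (fun j hj => hz j (by omega))
      (by omega)).seq (runs_bind (runs_test _ _ _ _) (Runs.seq (runs_instr _ _ _ _ _ _) ?_))
    convert runs_clear s _ _ _ using 2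
    · rfl
    · rw [update_idem]
      conv_lhs => rw [← update_eq_self s ρ, h0]
    · simp [denote, h0]
  | seq p q ihp ihq =>
    simp only [toExpr, Expr.fresh, Expr.cost, max_le_iff] at hs hB
    have := (ihp s ρ o hs.1 hz (by omega)).seq (ihq s ρ _ hs.2 hz (by omega))
    simpa [compile, denote] using this
  | forEach i b p ih =>
    simp only [toExpr, Expr.fresh, Expr.cost, max_le_iff] at hs hB
    have h0 := hz s le_rfl
    have h0' := hz (s + 1) (by omega)
    have hb := b.eval_le_cost x ρ
    refine (b.runs_compile s (s + 2) ρ o (by omega) (by omega) (fun j hj => hz j (by omega))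
      (by omega)).seq ?_
    have := runs_forLoop (x := x) (B := B) i s (by omega) (p.compile (s + 2)) (b.eval x ρ)
      (fun _ => ρ) (fun j => o ++ (List.range j).flatMap fun j => p.denote x (update ρ i j))
      (fun _ => h0) (fun _ => h0') (fun _ => rfl) (by omega) (by omega)
      (fun j hj => by
        have hag : ∀ l < p.toExpr.fresh, update (update (update ρ i j) s (b.eval x ρ - j - 1))
            (s + 1) (ρ i) l = update ρ i j l := fun l hl => by
          simp [show l ≠ s by omega, show l ≠ s + 1 by omega]
        have hd := p.denote_congr x hag
        have hc := (p.toExpr.eval_cost_congr x hag).2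
        convert ih (s + 2) _ _ (by omega) (fun l hl => ?_) ?_ using 2
        · rw [hd, List.range_succ]
          simp
        · simp [show l ≠ s by omega, show l ≠ s + 1 by omega, show l ≠ i by omega,
            hz l (by omega)]
        · rw [hc]
          have := Finset.single_le_sum (f := fun l => p.toExpr.cost x (update ρ i l))
            (fun _ _ => Nat.zero_le _) (Finset.mem_range.2 hj)
          omega)
    convert this using 2
    · simp [h0]
    · simp
    · rfl

/-- The output of a program is computed in logarithmic space. -/
theorem exists_transducer (p : Prog) : ∃ (M : Transducer) (c : ℕ), ∀ x : List Bool,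
    M.OutputsInSpace x (p.denote x fun _ => 0) (c * (Nat.log 2 x.length + 1)) := by
  obtain ⟨d, hd⟩ := p.toExpr.cost_le_pow
  have hfin := (p.compile p.toExpr.fresh).fin
  obtain ⟨T, hT⟩ := (Set.finite_range (p.compile p.toExpr.fresh).reg).bddAbove
  refine ⟨(p.compile p.toExpr.fresh).toTransducer (T + 1)
    (fun q => Nat.lt_succ_of_le (hT ⟨q, rfl⟩)), 3 * d + 3, fun x => ?_⟩
  -- The summand `2` provides a base of at least two also for the empty input.
  have h1 := p.runs_compile (x := x) (B := (x.length + 2) ^ d) p.toExpr.fresh (fun _ => 0) []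
    le_rfl (fun _ _ => rfl) (hd x _ _ (by omega) (by omega) (fun _ => by omega))
  refine Frag.outputsInSpace _ _ _ h1 ?_
  have h2 : Nat.log 2 ((x.length + 2) ^ d) < d * (Nat.log 2 x.length + 2) + 1 := by
    refine Nat.log_lt_of_lt_pow (by positivity) ?_
    have h3 : x.length + 2 ≤ 2 ^ (Nat.log 2 x.length + 2) := by
      have h4 := Nat.lt_pow_succ_log_self (b := 2) (by norm_num) x.length
      have h5 : 2 ≤ 2 ^ (Nat.log 2 x.length + 1) := Nat.le_self_pow (by omega) 2
      calc x.length + 2 ≤ 2 ^ (Nat.log 2 x.length + 1) + 2 ^ (Nat.log 2 x.length + 1) := by omega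
        _ = _ := by ring
    calc (x.length + 2) ^ d ≤ (2 ^ (Nat.log 2 x.length + 2)) ^ d := Nat.pow_le_pow_left h3 d
      _ = 2 ^ (d * (Nat.log 2 x.length + 2)) := by rw [← pow_mul, mul_comm]
      _ < _ := Nat.pow_lt_pow_right (by norm_num) (by omega)
  nlinarith [Nat.zero_le (Nat.log 2 x.length), Nat.zero_le d,
    Nat.zero_le (d * Nat.log 2 x.length)]

end Prog

end LogSpace

/-! ### Sequences of steps -/

/-- `b` is reached from `a` in exactly `m` steps. -/
def Steps {α : Type} (R : α → α → Prop) : ℕ → α → α → Prop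
  | 0, a, b => a = b
  | m + 1, a, b => ∃ c, R a c ∧ Steps R m c b

theorem Steps.trans {α : Type} {R : α → α → Prop} {m m' : ℕ} {a b c : α} (h : Steps R m a b)
    (h' : Steps R m' b c) : Steps R (m + m') a c := by
  induction m generalizing a with
  | zero =>
    obtain rfl : a = b := h
    simpa using h'
  | succ m ih =>
    obtain ⟨d, hd, h⟩ := h
    rw [Nat.add_right_comm]
    exact ⟨d, hd, ih h⟩

theorem steps_iff_exists_seq {α : Type} {R : α → α → Prop} {m : ℕ} {a b : α} :
    Steps R m a b ↔ ∃ S : ℕ → α, S 0 = a ∧ S m = b ∧ ∀ t < m, R (S t) (S (t + 1)) := by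
  induction m generalizing a with
  | zero =>
    refine ⟨fun h => ⟨fun _ => a, rfl, h, fun t ht => absurd ht t.not_lt_zero⟩, ?_⟩
    rintro ⟨S, rfl, rfl, -⟩
    rfl
  | succ m ih =>
    constructor
    · rintro ⟨c, hc, h⟩
      obtain ⟨S, h0, hm, hS⟩ := ih.1 h
      refine ⟨fun t => Nat.casesOn t a S, rfl, hm, fun t ht => ?_⟩
      rcases t with _ | t
      · simpa [h0] using hc
      · exact hS t (by omega)
    · rintro ⟨S, rfl, hm, hS⟩
      exact ⟨S 1, hS 0 (by omega), ih.2 ⟨fun t => S (t + 1), rfl, hm, fun t ht =>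
        hS (t + 1) (by omega)⟩⟩

/-- Putting `P` into the step relation loses it for the first member, which matters already for
length 0; `ha` supplies it. -/
theorem exists_seq_iff_steps {α : Type} {P : α → Prop} {R : α → α → Prop} {m : ℕ} {a b : α}
    (ha : P a) : (∃ S : ℕ → α, S 0 = a ∧ S m = b ∧ (∀ t ≤ m, P (S t)) ∧
      ∀ t < m, R (S t) (S (t + 1))) ↔ Steps (fun a b => P a ∧ P b ∧ R a b) m a b := by
  rw [steps_iff_exists_seq]
  constructor
  · rintro ⟨S, h0, hl, h1, h2⟩
    exact ⟨S, h0, hl, fun t ht => ⟨h1 t ht.le, h1 (t + 1) ht, h2 t ht⟩⟩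
  · rintro ⟨S, h0, hl, h⟩
    refine ⟨S, h0, hl, fun t ht => ?_, fun t ht => (h t ht).2.2⟩
    rcases t with _ | t
    · exact h0 ▸ ha
    · exact (h t ht).2.1

theorem Steps.map {α β : Type} {R : α → α → Prop} {R' : β → β → Prop} (f : α → β)
    (hf : ∀ a b, R a b → R' (f a) (f b)) {m : ℕ} {a b : α} (h : Steps R m a b) :
    Steps R' m (f a) (f b) := by
  induction m generalizing a with
  | zero => exact congrArg f h
  | succ m ih =>
    obtain ⟨c, hc, h⟩ := h
    exact ⟨f c, hf _ _ hc, ih h⟩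

theorem Steps.exists_lift {α β : Type} {R : α → α → Prop} {R' : β → β → Prop} (f : α → β)
    (hf : ∀ a b, R' (f a) b → ∃ a', f a' = b ∧ R a a') {m : ℕ} {a : α} {b : β}
    (h : Steps R' m (f a) b) : ∃ a', f a' = b ∧ Steps R m a a' := by
  induction m generalizing a with
  | zero => exact ⟨a, h, rfl⟩
  | succ m ih =>
    obtain ⟨c, hc, h⟩ := h
    obtain ⟨a', rfl, ha'⟩ := hf _ _ hc
    obtain ⟨a'', rfl, h'⟩ := ih h
    exact ⟨a'', rfl, a', ha', h'⟩

/-! ### The reduction -/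

namespace Reduction

open Function

/-- The vertices of the new graph: the places of the `k` tokens (the places `cp i (some u)` and the
parking place `cp i none`), the two places of the switch, the place of the guardian, and vertices
`dv`, `park` and `sep` that express constraints on the positions of the other tokens. -/
inductive Vtx (n k : ℕ) where
  | cp (i : Fin k) (u : Option (Fin n))
  | sw (b : Bool)
  | guardian
  | dv (v : Fin n)
  | park (i : Fin k)
  | sep (i j : Fin k) (v : Option (Fin n))

open Vtx

section

variable {n k : ℕ}

/-- The constraint vertices need a token set too. They share that of the guardian, whose token can
never leave it for them. -/
def part : Vtx n k → Fin (k + 2)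
  | cp i _ => i.castAdd 2
  | sw _ => Fin.natAdd k 0
  | _ => Fin.natAdd k 1

/-- The positions that the tokens take when token `i` is at `p i` and the switch at `b`. -/
def InConf (p : Fin k → Option (Fin n)) (b : Bool) : Vtx n k → Prop
  | cp i u => p i = u
  | sw c => c = b
  | guardian => True
  | _ => False

theorem existsUnique_inConf (p : Fin k → Option (Fin n)) (b : Bool) (t : Fin (k + 2)) :
    ∃! w, part w = t ∧ InConf p b w := by
  refine Fin.addCases (fun i => ?_) (fun i => ?_) t
  · refine ⟨cp i (p i), ⟨rfl, rfl⟩, ?_⟩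
    rintro (⟨j, u⟩ | _ | _ | _ | _ | _) ⟨h, h'⟩ <;> simp [part, InConf, Fin.ext_iff] at h h'
    · obtain rfl : j = i := Fin.ext h
      rw [h']
    all_goals omega
  · match i with
    | 0 =>
      refine ⟨sw b, ⟨rfl, rfl⟩, ?_⟩
      rintro (⟨j, u⟩ | _ | _ | _ | _ | _) ⟨h, h'⟩ <;> simp [part, InConf, Fin.ext_iff] at h h'
      · omega
      · rw [h']
    | 1 =>
      refine ⟨guardian, ⟨rfl, trivial⟩, ?_⟩
      rintro (⟨j, u⟩ | _ | _ | _ | _ | _) ⟨h, h'⟩ <;> simp [part, InConf, Fin.ext_iff] at h h'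
      · omega
      · rfl

theorem inConf_injective {p p' : Fin k → Option (Fin n)} {b b' : Bool}
    (h : ∀ w, InConf p b w ↔ InConf p' b' w) : p = p' ∧ b = b' :=
  ⟨funext fun i => ((h (cp i (p i))).1 rfl).symm, (h (sw b)).1 rfl⟩

end

variable (A : TSDomInstance)

/-- The moves of a token on its places, in one direction. -/
def Arc : Option (Fin A.n) → Option (Fin A.n) → Prop
  | some u, some v => A.G.Adj u v
  | some u, none => u ∈ A.Dfin
  | none, _ => False

/-- The switch dominates all token places and its own other place, so only constraint vertices and
the guardian matter. `dv` and `sep` are switched off by `sw true`, `park` by `sw false`. At `sw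
false`, `sep i j v` with `i ≠ j` forbids both tokens to be at `v`, and `sep i i none` forbids token
`i` to be parked; the remaining `sep i i v` are dominated outright. -/
def rel : Vtx A.n A.k → Vtx A.n A.k → Prop
  | cp i u, cp j v => i = j ∧ Arc A u v
  | sw _, cp _ _ => True
  | sw b, sw c => b = false ∧ c = true
  | dv _, sw b => b = true
  | dv v, cp _ u => ∃ u', u = some u' ∧ (u' = v ∨ A.G.Adj u' v)
  | park _, sw b => b = false
  | park i, cp j u => j = i ∧ ∀ v, u = some v → v ∈ A.Dfin
  | sep i j v, sw b => b = true ∨ (i = j ∧ v ≠ none)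
  | sep i j v, cp l u => (l = i ∨ l = j) ∧ u ≠ v
  | _, _ => False

def graph : SimpleGraph (Vtx A.n A.k) := SimpleGraph.fromRel (rel A)

/-- The positions of the tokens that satisfy all constraints. -/
def Valid (p : Fin A.k → Option (Fin A.n)) : Bool → Prop
  | false => (∀ v, ∃ i u, p i = some u ∧ (u = v ∨ A.G.Adj u v)) ∧ (∀ i, p i ≠ none) ∧ Injective p
  | true => ∀ i v, p i = some v → v ∈ A.Dfin

def Dominates (X : Vtx A.n A.k → Prop) : Prop := ∀ w, X w ∨ ∃ w', X w' ∧ (graph A).Adj w' w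

theorem dominates_inConf_iff {p : Fin A.k → Option (Fin A.n)} {b : Bool} :
    Dominates A (InConf p b) ↔ Valid A p b := by
  constructor
  · intro h
    cases b
    · refine ⟨fun v => ?_, fun i hi => ?_, fun i j hij => ?_⟩
      · obtain h | ⟨w', hw', h⟩ := h (dv v)
        · exact h.elim
        · rcases w' with ⟨i, u⟩ | _ | _ | _ | _ | _ <;>
            simp [graph, SimpleGraph.fromRel_adj, rel, InConf] at h hw'
          · obtain ⟨u', rfl, h⟩ := h
            exact ⟨i, u', hw', h⟩
          · simp_all
      · obtain h | ⟨w', hw', h⟩ := h (sep i i none)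
        · exact h.elim
        · rcases w' with ⟨i, u⟩ | _ | _ | _ | _ | _ <;>
            simp [graph, SimpleGraph.fromRel_adj, rel, InConf] at h hw' <;> simp_all
      · by_contra hne
        obtain h | ⟨w', hw', h⟩ := h (sep i j (p i))
        · exact h.elim
        · rcases w' with ⟨l, u⟩ | _ | _ | _ | _ | _ <;>
            simp [graph, SimpleGraph.fromRel_adj, rel, InConf] at h hw'
          · obtain ⟨rfl | rfl, h⟩ := h <;> simp_all
          · simp_all
    · intro i v hv
      obtain h | ⟨w', hw', h⟩ := h (park i)
      · exact h.elim
      · rcases w' with ⟨l, u⟩ | _ | _ | _ | _ | _ <;>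
          simp [graph, SimpleGraph.fromRel_adj, rel, InConf] at h hw'
        · obtain ⟨rfl, h⟩ := h
          exact h v (hw'.symm.trans hv)
        · simp_all
  · intro h w
    rcases w with ⟨i, u⟩ | c | _ | v | i | ⟨i, j, v⟩
    · exact .inr ⟨sw b, rfl, by simp [graph, rel]⟩
    · by_cases hc : c = b
      · exact .inl hc
      · refine .inr ⟨sw b, rfl, ?_⟩
        cases b <;> cases c <;> simp_all [graph, rel]
    · exact .inl trivial
    · cases b
      · obtain ⟨i, u, hi, hu⟩ := h.1 v
        exact .inr ⟨cp i (some u), hi, by simp [graph, rel, hu]⟩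
      · exact .inr ⟨sw true, rfl, by simp [graph, rel]⟩
    · cases b
      · exact .inr ⟨sw false, rfl, by simp [graph, rel]⟩
      · exact .inr ⟨cp i (p i), rfl, by simpa [graph, rel] using h i⟩
    · cases b
      · by_cases hij : i = j ∧ v ≠ none
        · exact .inr ⟨sw false, rfl, by simpa [graph, rel] using hij⟩
        · by_cases hi : p i = v
          · refine .inr ⟨cp j (p j), rfl, ?_⟩
            -- If both tokens were at `v`, injectivity would give `i = j`, and `v` would not be the
            -- parking place: the case just excluded.
            have : p j ≠ v := by
              rintro rfl
              exact hij ⟨h.2.2 hi, h.2.1 j⟩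
            simpa [graph, rel] using this
          · exact .inr ⟨cp i (p i), rfl, by simpa [graph, rel] using hi⟩
      · exact .inr ⟨sw true, rfl, by simp [graph, rel]⟩

/-- The guardian is isolated, so it belongs to `X` and uses up the last token set; the other token
sets consist of token places and switch places only. -/
theorem exists_inConf_of_dominates {X : Vtx A.n A.k → Prop} (h : ∀ t, ∃! w, part w = t ∧ X w)
    (hX : Dominates A X) : ∃ p b, ∀ w, X w ↔ InConf p b w := by
  have hg : X guardian := by
    obtain h | ⟨w', hw', h⟩ := hX guardian
    · exact h
    · rcases w' with _ | _ | _ | _ | _ | _ <;> simp [graph, rel] at h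
  have hcp : ∀ i : Fin A.k, ∃ u, X (cp i u) := by
    intro i
    obtain ⟨w, ⟨hw, hXw⟩, -⟩ := h (i.castAdd 2)
    rcases w with ⟨j, u⟩ | _ | _ | _ | _ | _ <;> simp [part, Fin.ext_iff] at hw
    · obtain rfl : j = i := Fin.ext hw
      exact ⟨u, hXw⟩
    all_goals omega
  have hsw : ∃ b, X (sw b) := by
    obtain ⟨w, ⟨hw, hXw⟩, -⟩ := h (Fin.natAdd A.k 0)
    rcases w with ⟨j, u⟩ | _ | _ | _ | _ | _ <;> simp [part, Fin.ext_iff] at hw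
    · omega
    · exact ⟨_, hXw⟩
  choose p hp using hcp
  obtain ⟨b, hb⟩ := hsw
  refine ⟨p, b, fun w => ⟨fun hw => ?_, fun hw => ?_⟩⟩
  · obtain ⟨w', ⟨h1, h2⟩, h3⟩ := existsUnique_inConf p b (part w)
    have hw' : X w' := by
      rcases w' with _ | _ | _ | _ | _ | _ <;> simp [InConf] at h2
      · rw [← h2]
        exact hp _
      · rw [h2]
        exact hb
      · exact hg
    rwa [(h (part w)).unique ⟨rfl, hw⟩ ⟨h1, hw'⟩]
  · rcases w with _ | _ | _ | _ | _ | _ <;> simp [InConf] at hw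
    · rw [← hw]
      exact hp _
    · rw [hw]
      exact hb
    · exact hg

/-- One slide of a token or of the switch. -/
def Move (c c' : (Fin A.k → Option (Fin A.n)) × Bool) : Prop :=
  (c'.1 = c.1 ∧ c'.2 = !c.2) ∨
    (c'.2 = c.2 ∧ ∃ i w, (Arc A (c.1 i) w ∨ Arc A w (c.1 i)) ∧ c'.1 = update c.1 i w)

theorem arc_irrefl (u : Option (Fin A.n)) : ¬ Arc A u u := by
  cases u <;> simp [Arc]

/-- An occupied vertex has edges inside its token set only if it is a place of a token or of the
switch. -/
theorem move_iff (p p' : Fin A.k → Option (Fin A.n)) (b b' : Bool) :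
    Move A (p, b) (p', b') ↔ ∃ w w', part w = part w' ∧ InConf p b w ∧ ¬ InConf p b w' ∧
      (graph A).Adj w w' ∧ ∀ a, InConf p' b' a ↔ a = w' ∨ (a ≠ w ∧ InConf p b a) := by
  constructor
  · rintro (⟨h1, h2⟩ | ⟨h1, i, u, h2, h3⟩)
    · simp only at h1 h2
      subst h1 h2
      refine ⟨sw b, sw (!b), rfl, rfl, by simp [InConf], by cases b <;> simp [graph, rel], ?_⟩
      rintro (_ | c | _ | _ | _ | _) <;> simp [InConf]
    · simp only at h1 h2 h3
      subst h1 h3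
      have hne : p i ≠ u := by
        rintro rfl
        simp [arc_irrefl] at h2
      refine ⟨cp i (p i), cp i u, rfl, rfl, hne, by simpa [graph, rel, hne] using h2, ?_⟩
      rintro (⟨j, v⟩ | _ | _ | _ | _ | _) <;> simp [InConf]
      by_cases hj : j = i
      · subst hj
        simp only [update_self, true_and, true_implies]
        grind
      · simp [hj]
  · rintro ⟨w, w', hpart, hw, hw', hadj, h⟩
    rcases w with ⟨i, u⟩ | c | _ | _ | _ | _
    · rcases w' with ⟨j, v⟩ | c | _ | _ | _ | _ <;> simp [part, Fin.ext_iff] at hpart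
      · obtain rfl : i = j := Fin.ext hpart
        obtain rfl : p i = u := hw
        refine .inr ⟨(h (sw b)).2 (.inr ⟨by simp, rfl⟩) |>.symm, i, v, ?_, funext fun j => ?_⟩
        · simpa [graph, rel] using hadj.2
        · by_cases hj : j = i
          · subst hj
            simpa [InConf] using (h (cp j v)).2 (.inl rfl)
          · simpa [hj, InConf] using (h (cp j (p j))).2 (.inr ⟨by simp [hj], rfl⟩)
      all_goals omega
    · rcases w' with ⟨j, v⟩ | c' | _ | _ | _ | _ <;> simp [part, Fin.ext_iff] at hpart
      · omega
      · obtain rfl : c = b := hw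
        refine .inl ⟨funext fun j => (h (cp j (p j))).2 (.inr ⟨by simp, rfl⟩), ?_⟩
        have : c' = b' := (h (sw c')).2 (.inl rfl)
        have hne : c' ≠ c := hw'
        simp only
        rw [← this]
        cases c <;> cases c' <;> simp_all
    · rcases w' with _ | _ | _ | _ | _ | _ <;> simp [graph, rel] at hadj
    all_goals exact hw.elim

/-! ### Translating sequences between the two instances -/

/-- One step of a reconfiguration sequence for the new instance. -/
def NewStep (c c' : (Fin A.k → Option (Fin A.n)) × Bool) : Prop :=
  Valid A c.1 c.2 ∧ Valid A c'.1 c'.2 ∧ Move A c c'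

/-- One step of a reconfiguration sequence for the given instance. -/
def OldStep (D D' : Finset (Fin A.n)) : Prop :=
  (IsDominatingSet A.G D ∧ D.card = A.k) ∧ (IsDominatingSet A.G D' ∧ D'.card = A.k) ∧
    ∃ u v, TokenSlide A.G u v D D'

theorem admitsLength_iff (ℓ : ℕ) : A.AdmitsLength ℓ ↔ Steps (OldStep A) ℓ A.Dinit A.Dfin :=
  exists_seq_iff_steps (P := fun D => IsDominatingSet A.G D ∧ D.card = A.k)
    (R := fun D D' => ∃ u v, TokenSlide A.G u v D D') ⟨A.init_dom, A.init_card⟩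

/-- The vertices occupied by the tokens. -/
def occupied {n k : ℕ} (p : Fin k → Option (Fin n)) : Finset (Fin n) :=
  Finset.univ.filter fun v => ∃ i, p i = some v

theorem mem_occupied {n k : ℕ} {p : Fin k → Option (Fin n)} {v : Fin n} :
    v ∈ occupied p ↔ ∃ i, p i = some v := by
  simp [occupied]

theorem card_occupied {n k : ℕ} {p : Fin k → Option (Fin n)} (hp : ∀ i, p i ≠ none)
    (hinj : Injective p) : (occupied p).card = k := by
  choose q hq using fun i => Option.ne_none_iff_exists'.1 (hp i)
  have : occupied p = Finset.univ.image q := by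
    ext v
    simp [mem_occupied, hq]
  rw [this, Finset.card_image_of_injective, Finset.card_fin]
  intro i j hij
  exact hinj (by rw [hq, hq, hij])

theorem valid_false_iff {p : Fin A.k → Option (Fin A.n)} : Valid A p false ↔
    IsDominatingSet A.G (occupied p) ∧ (∀ i, p i ≠ none) ∧ Injective p := by
  refine and_congr_left' (forall_congr' fun v => ?_)
  simp only [mem_occupied]
  constructor
  · rintro ⟨i, u, hi, rfl | h⟩
    · exact .inl ⟨i, hi⟩
    · exact .inr ⟨u, ⟨i, hi⟩, h⟩
  · rintro (⟨i, hi⟩ | ⟨u, ⟨i, hi⟩, h⟩)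
    · exact ⟨i, v, hi, .inl rfl⟩
    · exact ⟨i, u, hi, .inr h⟩

theorem occupied_update {n k : ℕ} {p : Fin k → Option (Fin n)} (hinj : Injective p) {i : Fin k}
    {u v : Fin n} (hi : p i = some u) :
    occupied (update p i (some v)) = insert v ((occupied p).erase u) := by
  ext a
  simp only [mem_occupied, Finset.mem_insert, Finset.mem_erase]
  constructor
  · rintro ⟨j, hj⟩
    by_cases hji : j = i
    · subst hji
      simp only [update_self, Option.some.injEq] at hj
      exact .inl hj.symm
    · rw [update_of_ne hji] at hj
      refine .inr ⟨?_, j, hj⟩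
      rintro rfl
      exact hji (hinj (hj.trans hi.symm))
  · rintro (rfl | ⟨hne, j, hj⟩)
    · exact ⟨i, by simp⟩
    · refine ⟨j, ?_⟩
      rw [update_of_ne, hj]
      rintro rfl
      rw [hi, Option.some.injEq] at hj
      exact hne hj.symm

theorem exists_newStep {p : Fin A.k → Option (Fin A.n)} (hp : Valid A p false)
    {D : Finset (Fin A.n)} (h : OldStep A (occupied p) D) :
    ∃ p', occupied p' = D ∧ Valid A p' false ∧ NewStep A (p, false) (p', false) := by
  obtain ⟨-, ⟨hD, hc⟩, u, v, hu, hv, huv, rfl⟩ := h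
  obtain ⟨i, hi⟩ := mem_occupied.1 hu
  obtain ⟨-, hp1, hp2⟩ := id hp
  have ho := occupied_update hp2 (v := v) hi
  have hv' : ∀ j, p j ≠ some v := fun j hj => hv (mem_occupied.2 ⟨j, hj⟩)
  have hval : Valid A (update p i (some v)) false := by
    rw [valid_false_iff, ho]
    refine ⟨hD, fun j => ?_, fun j l hjl => ?_⟩
    · by_cases hj : j = i <;> simp [hj, hp1]
    · by_cases hj : j = i <;> by_cases hl : l = i <;> simp [hj, hl] at hjl ⊢
      · exact hv' l hjl.symm |>.elim
      · exact (hv' j hjl).elim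
      · exact hp2 hjl
  exact ⟨_, ho, hval, hp, hval, .inr ⟨rfl, i, some v, .inl (by simpa [hi, Arc] using huv), rfl⟩⟩

/-- With the switch still at `false` after the slide, its target is not a parking place, and
injectivity of `p'` shows that no other token stands on the same old vertex. -/
theorem oldStep_of_newStep {p p' : Fin A.k → Option (Fin A.n)}
    (h : NewStep A (p, false) (p', false)) : OldStep A (occupied p) (occupied p') := by
  obtain ⟨h1, h2, h3⟩ := h
  simp only at h1 h2
  obtain ⟨hd, hn, hi⟩ := (valid_false_iff A).1 h1
  obtain ⟨hd', hn', hi'⟩ := (valid_false_iff A).1 h2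
  refine ⟨⟨hd, card_occupied hn hi⟩, ⟨hd', card_occupied hn' hi'⟩, ?_⟩
  obtain ⟨-, h⟩ | ⟨-, i, w, hw, h⟩ := h3
  · simp at h
  · simp only at h hw
    obtain ⟨u, hu⟩ := Option.ne_none_iff_exists'.1 (hn i)
    obtain ⟨v, rfl⟩ : ∃ v, w = some v := by
      refine Option.ne_none_iff_exists'.1 ?_
      rintro rfl
      exact hn' i (by simp [h])
    have huv : A.G.Adj u v := by
      rw [hu] at hw
      exact hw.elim id fun h => h.symm
    refine ⟨u, v, mem_occupied.2 ⟨i, hu⟩, fun hv => ?_, huv, ?_⟩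
    · obtain ⟨j, hj⟩ := mem_occupied.1 hv
      have hji : j ≠ i := by
        rintro rfl
        rw [hu, Option.some.injEq] at hj
        exact huv.ne hj
      exact hji (hi' (by simp [h, hji, hj]))
    · rw [h, occupied_update hi hu]

theorem exists_newSteps {ℓ : ℕ} {p : Fin A.k → Option (Fin A.n)} (hp : Valid A p false)
    {D : Finset (Fin A.n)} (h : Steps (OldStep A) ℓ (occupied p) D) :
    ∃ p', occupied p' = D ∧ Valid A p' false ∧ Steps (NewStep A) ℓ (p, false) (p', false) := by
  induction ℓ generalizing p with
  | zero => exact ⟨p, h, hp, rfl⟩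
  | succ ℓ ih =>
    obtain ⟨D', h1, h2⟩ := h
    obtain ⟨p1, rfl, hp1, hs⟩ := exists_newStep A hp h1
    obtain ⟨p2, ho, hp2, hs2⟩ := ih hp1 h2
    exact ⟨p2, ho, hp2, _, hs, hs2⟩

/-- The number of tokens that are not parked. -/
def unparked {n k : ℕ} (p : Fin k → Option (Fin n)) : ℕ :=
  (Finset.univ.filter fun i => p i ≠ none).card

theorem unparked_update {n k : ℕ} (p : Fin k → Option (Fin n)) (i : Fin k) (hi : p i ≠ none) :
    unparked (update p i none) + 1 = unparked p := by
  have : (Finset.univ.filter fun j => update p i none j ≠ none) =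
      (Finset.univ.filter fun j => p j ≠ none).erase i := by
    ext j
    by_cases hj : j = i <;> simp [hj]
  rw [unparked, unparked, this, Finset.card_erase_add_one (by simpa using hi)]

theorem unparked_le_update {n k : ℕ} (p : Fin k → Option (Fin n)) (i : Fin k)
    (w : Option (Fin n)) : unparked p ≤ unparked (update p i w) + 1 := by
  have : (Finset.univ.filter fun j => p j ≠ none) ⊆
      insert i (Finset.univ.filter fun j => update p i w j ≠ none) := by
    intro j hj
    by_cases hji : j = i <;> simp_all
  exact (Finset.card_le_card this).trans (Finset.card_insert_le _ _)

/-- An unparked token is on a vertex of `A.Dfin`, which has an edge to the parking place, and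
parking keeps the conditions for `true`; so the tokens can be parked one by one. -/
theorem steps_park (m : ℕ) (p : Fin A.k → Option (Fin A.n)) (hp : Valid A p true)
    (hm : unparked p = m) : Steps (NewStep A) m (p, true) (fun _ => none, true) := by
  induction m generalizing p with
  | zero =>
    simp only [unparked, Finset.card_eq_zero, Finset.filter_eq_empty_iff, not_not] at hm
    exact Prod.ext (funext fun i => hm (Finset.mem_univ i)) rfl
  | succ m ih =>
    have hpos : 0 < unparked p := by omega
    obtain ⟨i, hi⟩ := Finset.card_pos.1 hpos
    simp only [Finset.mem_filter, Finset.mem_univ, true_and] at hi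
    obtain ⟨u, hu⟩ := Option.ne_none_iff_exists'.1 hi
    have hval : Valid A (update p i none) true := by
      intro j v hj
      by_cases hji : j = i
      · simp [hji] at hj
      · exact hp j v (by simpa [hji] using hj)
    have := unparked_update p i hi
    exact ⟨(update p i none, true), ⟨hp, hval, .inr ⟨rfl, i, none, .inl (by
      simpa [hu, Arc] using hp i u hu), rfl⟩⟩, ih _ hval (by omega)⟩

/-- Flipping the switch parks nobody, and a slide of a token parks at most one. -/
theorem unparked_le_of_steps {m : ℕ} {c : (Fin A.k → Option (Fin A.n)) × Bool}
    (h : Steps (NewStep A) m c (fun _ => none, true)) : unparked c.1 ≤ m := by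
  induction m generalizing c with
  | zero =>
    obtain rfl : c = (fun _ => none, true) := h
    simp [unparked]
  | succ m ih =>
    obtain ⟨c', ⟨-, -, hm⟩, h⟩ := h
    have := ih h
    obtain ⟨h1, -⟩ | ⟨-, i, w, -, h1⟩ := hm
    · rw [h1] at this
      omega
    · rw [h1] at this
      have := unparked_le_update c.1 i w
      omega

theorem unparked_of_valid {p : Fin A.k → Option (Fin A.n)} (hp : Valid A p false) :
    unparked p = A.k := by
  rw [unparked, Finset.filter_true_of_mem fun i _ => hp.2.1 i, Finset.card_fin]

theorem exists_steps_of_oldSteps {ℓ : ℕ} {p : Fin A.k → Option (Fin A.n)} (hp : Valid A p false)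
    (h : Steps (OldStep A) ℓ (occupied p) A.Dfin) :
    Steps (NewStep A) (ℓ + A.k + 1) (p, false) (fun _ => none, true) := by
  obtain ⟨p', ho, hp', hs⟩ := exists_newSteps A hp h
  have hp1 : Valid A p' true := fun i v hi => ho ▸ mem_occupied.2 ⟨i, hi⟩
  exact hs.trans (m' := A.k + 1) ⟨(p', true), ⟨hp', hp1, .inl ⟨rfl, rfl⟩⟩,
    steps_park A A.k p' hp1 (unparked_of_valid A hp')⟩

theorem exists_oldSteps {m : ℕ} {p : Fin A.k → Option (Fin A.n)} (hp : Valid A p false)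
    (h : Steps (NewStep A) m (p, false) (fun _ => none, true)) :
    ∃ ℓ, ℓ + A.k + 1 ≤ m ∧ Steps (OldStep A) ℓ (occupied p) A.Dfin := by
  induction m generalizing p with
  | zero => exact absurd (congrArg Prod.snd h) (by simp)
  | succ m ih =>
    obtain ⟨⟨p', b⟩, hs, h⟩ := h
    cases b
    · obtain ⟨ℓ, hl, hs'⟩ := ih hs.2.1 h
      exact ⟨ℓ + 1, by omega, _, oldStep_of_newStep A hs, hs'⟩
    · have hpp : p' = p := by
        obtain ⟨h1, -⟩ | ⟨h1, -⟩ := hs.2.2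
        · exact h1
        · simp at h1
      subst hpp
      -- At the first flip the old sequence is complete: the conditions for `true` put the occupied
      -- set inside `A.Dfin`, and those for `false` give it `k` elements.
      refine ⟨0, ?_, Finset.eq_of_subset_of_card_le (fun v hv => ?_) ?_⟩
      · have := unparked_le_of_steps A h
        simp only [unparked_of_valid A hp] at this
        omega
      · obtain ⟨i, hi⟩ := mem_occupied.1 hv
        exact hs.2.1 i v hi
      · rw [card_occupied hp.2.1 hp.2.2, A.fin_card]

end Reduction

namespace Reduction

open Function Vtx

/-! ### Numbering the new vertices -/

def pos {n : ℕ} : Option (Fin n) → ℕ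
  | some v => v
  | none => n

theorem finSuccEquivLast_symm_val {n : ℕ} (u : Option (Fin n)) :
    (finSuccEquivLast.symm u : ℕ) = pos u := by
  cases u <;> simp [pos]

def size (n k : ℕ) : ℕ := k * (n + 1) + (2 + (1 + (n + (k + k * k * (n + 1)))))

def vtxEquivSum (n k : ℕ) : Vtx n k ≃ (Fin k × Option (Fin n)) ⊕ (Bool ⊕ (Unit ⊕ (Fin n ⊕ (Fin k ⊕
    ((Fin k × Fin k) × Option (Fin n)))))) where
  toFun
    | cp i u => .inl (i, u)
    | sw b => .inr (.inl b)
    | guardian => .inr (.inr (.inl ()))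
    | dv v => .inr (.inr (.inr (.inl v)))
    | park i => .inr (.inr (.inr (.inr (.inl i))))
    | sep i j v => .inr (.inr (.inr (.inr (.inr ((i, j), v)))))
  invFun
    | .inl (i, u) => cp i u
    | .inr (.inl b) => sw b
    | .inr (.inr (.inl ())) => guardian
    | .inr (.inr (.inr (.inl v))) => dv v
    | .inr (.inr (.inr (.inr (.inl i)))) => park i
    | .inr (.inr (.inr (.inr (.inr ((i, j), v))))) => sep i j v
  left_inv w := by cases w <;> rfl
  right_inv w := by rcases w with _ | _ | _ | _ | _ | ⟨⟨_, _⟩, _⟩ <;> rfl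

/-- The kinds of vertices form consecutive blocks, numbered row by row with `none` last in its row.
The resulting closed formulas are what the logspace program computes with. -/
def enc (n k : ℕ) : Vtx n k ≃ Fin (size n k) :=
  (vtxEquivSum n k).trans <|
    ((Equiv.sumCongr
      ((Equiv.prodCongr (Equiv.refl _) finSuccEquivLast.symm).trans finProdFinEquiv)
      ((Equiv.sumCongr finTwoEquiv.symm ((Equiv.sumCongr finOneEquiv.symm
        ((Equiv.sumCongr (Equiv.refl _) ((Equiv.sumCongr (Equiv.refl _)
          ((Equiv.prodCongr finProdFinEquiv finSuccEquivLast.symm).trans finProdFinEquiv)).trans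
            finSumFinEquiv)).trans finSumFinEquiv)).trans finSumFinEquiv)).trans
              finSumFinEquiv)).trans finSumFinEquiv).trans (finCongr (by rw [size]))

section

variable {n k : ℕ}

theorem enc_cp (i : Fin k) (u : Option (Fin n)) :
    (enc n k (cp i u) : ℕ) = i * (n + 1) + pos u := by
  simp [enc, vtxEquivSum, finSuccEquivLast_symm_val]
  ring

theorem enc_sw (b : Bool) : (enc n k (sw b) : ℕ) = k * (n + 1) + b.toNat := by
  cases b <;> simp [enc, vtxEquivSum, finTwoEquiv]

theorem enc_guardian : (enc n k guardian : ℕ) = k * (n + 1) + 2 := by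
  simp [enc, vtxEquivSum]

theorem enc_dv (v : Fin n) : (enc n k (dv v) : ℕ) = k * (n + 1) + 3 + v := by
  simp [enc, vtxEquivSum]
  ring

theorem enc_park (i : Fin k) : (enc n k (park i) : ℕ) = k * (n + 1) + 3 + n + i := by
  simp [enc, vtxEquivSum]
  ring

theorem enc_sep (i j : Fin k) (v : Option (Fin n)) : (enc n k (sep i j v) : ℕ) =
    k * (n + 1) + 3 + n + k + (i * k + j) * (n + 1) + pos v := by
  simp [enc, vtxEquivSum, finSuccEquivLast_symm_val]
  ring

end

/-! ### The new instance -/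

variable (A : TSDomInstance)

def newGraph : SimpleGraph (Fin (size A.n A.k)) := (graph A).comap (enc A.n A.k).symm

def newPart (a : Fin (size A.n A.k)) : Fin (A.k + 2) := part ((enc A.n A.k).symm a)

open Classical in
/-- The set of occupied vertices for given positions of the tokens and the switch. -/
noncomputable def conf (c : (Fin A.k → Option (Fin A.n)) × Bool) : Finset (Fin (size A.n A.k)) :=
  Finset.univ.filter fun a => InConf c.1 c.2 ((enc A.n A.k).symm a)

theorem enc_mem_conf {c : (Fin A.k → Option (Fin A.n)) × Bool} {w : Vtx A.n A.k} :
    enc A.n A.k w ∈ conf A c ↔ InConf c.1 c.2 w := by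
  simp [conf]

theorem isDominatingSet_newGraph_iff {D : Finset (Fin (size A.n A.k))} :
    IsDominatingSet (newGraph A) D ↔ Dominates A fun w => enc A.n A.k w ∈ D := by
  rw [IsDominatingSet, (enc A.n A.k).surjective.forall]
  refine forall_congr' fun w => or_congr_right ?_
  rw [(enc A.n A.k).surjective.exists]
  simp [newGraph]

theorem onePerTokenSet_iff {D : Finset (Fin (size A.n A.k))} :
    OnePerTokenSet (newPart A) D ↔ ∀ t, ∃! w, part w = t ∧ enc A.n A.k w ∈ D := by
  refine forall_congr' fun t => ?_
  rw [Finset.card_eq_one, (enc A.n A.k).symm.bijective.existsUnique_iff]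
  simp only [Finset.ext_iff, Finset.mem_filter, Finset.mem_singleton, Equiv.apply_symm_apply]
  constructor
  · rintro ⟨a, ha⟩
    exact ⟨a, ((ha a).2 rfl).symm, fun b hb => (ha b).1 hb.symm⟩
  · rintro ⟨a, ha, hb⟩
    refine ⟨a, fun b => ⟨fun h => hb b h.symm, ?_⟩⟩
    rintro rfl
    exact ha.symm

theorem onePerTokenSet_conf (c : (Fin A.k → Option (Fin A.n)) × Bool) :
    OnePerTokenSet (newPart A) (conf A c) := by
  simpa only [onePerTokenSet_iff, enc_mem_conf] using existsUnique_inConf c.1 c.2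

theorem isDominatingSet_conf_iff {c : (Fin A.k → Option (Fin A.n)) × Bool} :
    IsDominatingSet (newGraph A) (conf A c) ↔ Valid A c.1 c.2 := by
  simp only [isDominatingSet_newGraph_iff, enc_mem_conf, dominates_inConf_iff]

theorem exists_eq_conf {D : Finset (Fin (size A.n A.k))} (hD : IsDominatingSet (newGraph A) D)
    (hD' : OnePerTokenSet (newPart A) D) : ∃ c, conf A c = D := by
  obtain ⟨p, b, h⟩ := exists_inConf_of_dominates A ((onePerTokenSet_iff A).1 hD')
    ((isDominatingSet_newGraph_iff A).1 hD)
  refine ⟨(p, b), Finset.ext ((enc A.n A.k).surjective.forall.2 fun w => ?_)⟩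
  rw [enc_mem_conf, h]

theorem conf_injective : Injective (conf A) := by
  intro c c' h
  obtain ⟨h1, h2⟩ := inConf_injective (p := c.1) (b := c.2) (p' := c'.1) (b' := c'.2) fun w => by
    rw [← enc_mem_conf, h, enc_mem_conf]
  exact Prod.ext h1 h2

theorem card_conf (c : (Fin A.k → Option (Fin A.n)) × Bool) : (conf A c).card = A.k + 2 := by
  rw [Finset.card_eq_sum_card_fiberwise (f := newPart A) (t := Finset.univ) (by simp),
    Finset.sum_congr rfl fun t _ => onePerTokenSet_conf A c t]
  simp

theorem move_iff_slide (c c' : (Fin A.k → Option (Fin A.n)) × Bool) : Move A c c' ↔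
    ∃ u v, newPart A u = newPart A v ∧ TokenSlide (newGraph A) u v (conf A c) (conf A c') := by
  rw [move_iff A c.1 c'.1 c.2 c'.2, (enc A.n A.k).surjective.exists]
  refine exists_congr fun w => ?_
  rw [(enc A.n A.k).surjective.exists]
  refine exists_congr fun w' => ?_
  simp only [newPart, TokenSlide, enc_mem_conf, newGraph, SimpleGraph.comap_adj,
    Equiv.symm_apply_apply, Finset.ext_iff, (enc A.n A.k).surjective.forall, Finset.mem_insert,
    Finset.mem_erase, EmbeddingLike.apply_eq_iff_eq, ne_eq]

/-- Any bijection from the tokens to `A.Dinit` would serve the combinatorics. The increasing one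
lets the program find the token on a vertex by counting the smaller elements of `A.Dinit`. -/
noncomputable def initPos (i : Fin A.k) : Option (Fin A.n) :=
  some (A.Dinit.orderEmbOfFin A.init_card i)

theorem occupied_initPos : occupied (initPos A) = A.Dinit := by
  ext v
  rw [mem_occupied]
  simp only [initPos, Option.some.injEq]
  exact Set.ext_iff.1 (Finset.range_orderEmbOfFin A.Dinit A.init_card) v

theorem valid_initPos : Valid A (initPos A) false := by
  rw [valid_false_iff, occupied_initPos]
  exact ⟨A.init_dom, by simp [initPos], fun i j h => by simpa [initPos] using h⟩

theorem valid_parked : Valid A (fun _ => none) true := fun _ _ h => by simp at h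

/-- The reduction. -/
noncomputable def newInstance : PartTSDomInstance where
  n := size A.n A.k
  k := A.k + 2
  G := newGraph A
  Dinit := conf A (initPos A, false)
  Dfin := conf A (fun _ => none, true)
  init_dom := (isDominatingSet_conf_iff A).2 (valid_initPos A)
  fin_dom := (isDominatingSet_conf_iff A).2 (valid_parked A)
  init_card := card_conf A _
  fin_card := card_conf A _
  part := newPart A
  init_part := onePerTokenSet_conf A _
  fin_part := onePerTokenSet_conf A _

/-- `conf` is injective and its range contains every legal token set, so sequences of vertex sets
correspond to sequences of positions. -/
theorem newInstance_admitsLength_iff (m : ℕ) : (newInstance A).AdmitsLength m ↔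
    Steps (NewStep A) m (initPos A, false) (fun _ => none, true) := by
  refine (exists_seq_iff_steps (P := fun D => IsDominatingSet (newGraph A) D ∧
    OnePerTokenSet (newPart A) D) (R := fun D D' => ∃ u v, newPart A u = newPart A v ∧
      TokenSlide (newGraph A) u v D D')
    ⟨(newInstance A).init_dom, (newInstance A).init_part⟩).trans ?_
  constructor
  · intro h
    obtain ⟨c, hc, h⟩ := Steps.exists_lift (R := NewStep A) (conf A) (fun c D hD => by
      obtain ⟨c', rfl⟩ := exists_eq_conf A hD.2.1.1 hD.2.1.2
      exact ⟨c', rfl, (isDominatingSet_conf_iff A).1 hD.1.1,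
        (isDominatingSet_conf_iff A).1 hD.2.1.1, (move_iff_slide A c c').2 hD.2.2⟩) h
    rwa [conf_injective A hc] at h
  · exact Steps.map (conf A) fun c c' h => ⟨⟨(isDominatingSet_conf_iff A).2 h.1,
      onePerTokenSet_conf A c⟩, ⟨(isDominatingSet_conf_iff A).2 h.2.1, onePerTokenSet_conf A c'⟩,
        (move_iff_slide A c c').1 h.2.2⟩

theorem newInstance_admitsLength {ℓ : ℕ} (h : A.AdmitsLength ℓ) :
    (newInstance A).AdmitsLength (ℓ + A.k + 1) := by
  rw [newInstance_admitsLength_iff]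
  refine exists_steps_of_oldSteps A (valid_initPos A) ?_
  rwa [occupied_initPos, ← admitsLength_iff]

theorem admitsLength_of_newInstance {m : ℕ} (h : (newInstance A).AdmitsLength m) :
    ∃ ℓ, ℓ + A.k + 1 ≤ m ∧ A.AdmitsLength ℓ := by
  rw [newInstance_admitsLength_iff] at h
  obtain ⟨ℓ, hl, h⟩ := exists_oldSteps A (valid_initPos A) h
  rw [occupied_initPos, ← admitsLength_iff] at h
  exact ⟨ℓ, hl, h⟩

theorem isYes_newInstance_iff : (∃ ℓ, A.AdmitsLength ℓ) ↔ ∃ m, (newInstance A).AdmitsLength m :=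
  ⟨fun ⟨_, h⟩ => ⟨_, newInstance_admitsLength A h⟩, fun ⟨_, h⟩ =>
    (admitsLength_of_newInstance A h).imp fun _ h => h.2⟩

end Reduction

/-! ### Reading the encoding -/

theorem List.getElem?_append_add {α : Type} (l l' : List α) (j : ℕ) :
    (l ++ l')[l.length + j]? = l'[j]? := by
  rw [List.getElem?_append_right (Nat.le_add_right _ _), Nat.add_sub_cancel_left]

theorem List.getElem?_flatMap_of_length {α β : Type} {m : ℕ} {g : α → List β}
    (hg : ∀ a, (g a).length = m) (l : List α) (i j : ℕ) (hj : j < m) :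
    (l.flatMap g)[i * m + j]? = l[i]?.bind fun a => (g a)[j]? := by
  induction l generalizing i with
  | nil => simp
  | cons a l ih =>
    rw [List.flatMap_cons]
    rcases i with _ | i
    · rw [List.getElem?_append_left (by simpa [hg] using hj)]
      simp
    · rw [show (i + 1) * m + j = (g a).length + (i * m + j) by rw [hg]; ring,
        List.getElem?_append_add, ih]
      simp

theorem List.getElem?_map_product_finRange {α : Type} {n m : ℕ} (f : Fin n × Fin m → α) (i : Fin n)
    (j : Fin m) : ((List.finRange n ×ˢ List.finRange m).map f)[(i : ℕ) * m + j]? =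
      some (f (i, j)) := by
  have h := List.getElem?_flatMap_of_length (m := m)
    (g := fun a => (List.finRange m).map (Prod.mk a)) (by simp) (List.finRange n) i j j.2
  rw [List.getElem?_map]
  change Option.map f ((List.finRange n).flatMap fun a => (List.finRange m).map (Prod.mk a))[_]? = _
  rw [h]
  simp

/-- Two numbers in unary, followed by further bits. -/
def unaryPair (n k : ℕ) (l : List Bool) : List Bool :=
  List.replicate n true ++ false :: (List.replicate k true ++ false :: l)

section

variable (n k : ℕ) (l : List Bool)

theorem getElem?_unaryPair_fst {j : ℕ} (hj : j < n) : (unaryPair n k l)[j]? = some true := by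
  rw [unaryPair, List.getElem?_append_left (by simpa using hj)]
  simp [hj]

theorem getElem?_unaryPair_fst_end : (unaryPair n k l)[n]? = some false := by
  simp [unaryPair]

theorem getElem?_unaryPair_add (j : ℕ) : (unaryPair n k l)[n + 1 + j]? =
    (List.replicate k true ++ false :: l)[j]? := by
  have h := List.getElem?_append_add (List.replicate n true ++ [false])
    (List.replicate k true ++ [false] ++ l) j
  rw [List.length_append, List.length_replicate] at h
  simpa [unaryPair] using h

theorem getElem?_unaryPair_snd {j : ℕ} (hj : j < k) :
    (unaryPair n k l)[n + 1 + j]? = some true := by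
  rw [getElem?_unaryPair_add, List.getElem?_append_left (by simpa using hj)]
  simp [hj]

theorem getElem?_unaryPair_snd_end : (unaryPair n k l)[n + 1 + k]? = some false := by
  rw [getElem?_unaryPair_add]
  simp

theorem getElem?_unaryPair_rest (j : ℕ) : (unaryPair n k l)[n + k + 2 + j]? = l[j]? := by
  have h := List.getElem?_append_add (List.replicate k true ++ [false]) l j
  rw [List.length_append, List.length_replicate] at h
  rw [show n + k + 2 + j = n + 1 + (k + 1 + j) by ring, getElem?_unaryPair_add, ← h]
  simp

end

namespace TSDomInstance

variable (A : TSDomInstance)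

open Classical in
theorem encode_eq : A.encode = unaryPair A.n A.k
    ((List.finRange A.n ×ˢ List.finRange A.n).map (fun p => decide (A.G.Adj p.1 p.2)) ++
      ((List.finRange A.n).map (fun v => decide (v ∈ A.Dinit)) ++
        (List.finRange A.n).map (fun v => decide (v ∈ A.Dfin)))) := rfl

theorem length_product_finRange (n : ℕ) : (List.finRange n ×ˢ List.finRange n).length = n * n :=
  (List.length_product _ _).trans (by simp)

theorem getElem?_encode_adj (u v : Fin A.n) :
    A.encode[A.n + A.k + 2 + (u * A.n + v)]? = some true ↔ A.G.Adj u v := by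
  have h : (u : ℕ) * A.n + v < A.n * A.n := by
    have := Nat.mul_le_mul_right A.n (Nat.succ_le_of_lt u.2)
    rw [Nat.succ_mul] at this
    omega
  rw [encode_eq, getElem?_unaryPair_rest,
    List.getElem?_append_left (by rwa [List.length_map, length_product_finRange]),
    List.getElem?_map_product_finRange]
  simp

theorem getElem?_encode_init (v : Fin A.n) :
    A.encode[A.n + A.k + 2 + (A.n * A.n + v)]? = some true ↔ v ∈ A.Dinit := by
  rw [encode_eq, getElem?_unaryPair_rest,
    List.getElem?_append_right (by simp [length_product_finRange]),
    List.length_map, length_product_finRange, Nat.add_sub_cancel_left,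
    List.getElem?_append_left (by simp)]
  simp

theorem getElem?_encode_fin (v : Fin A.n) :
    A.encode[A.n + A.k + 2 + (A.n * A.n + A.n + v)]? = some true ↔ v ∈ A.Dfin := by
  rw [encode_eq, getElem?_unaryPair_rest, add_assoc,
    List.getElem?_append_right (by simp [length_product_finRange]),
    List.length_map, length_product_finRange, Nat.add_sub_cancel_left,
    List.getElem?_append_right (by simp), List.length_map, List.length_finRange,
    Nat.add_sub_cancel_left]
  simp

end TSDomInstance

namespace LogSpace

open Function

namespace Expr

/-! ### Logical operations and unary numbers -/

def Holds (x : List Bool) (ρ : ℕ → ℕ) (e : Expr) : Prop := e.eval x ρ ≠ 0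

def zero : Expr := sub one one
def not (e : Expr) : Expr := sub one e
def lt (a b : Expr) : Expr := sub b a
def eq (a b : Expr) : Expr := not (add (sub a b) (sub b a))

section

variable {x : List Bool} {ρ : ℕ → ℕ} {a b : Expr}

@[simp] theorem holds_zero : ¬ Holds x ρ zero := by simp [Holds, zero, eval]

@[simp] theorem holds_not : Holds x ρ (not a) ↔ ¬ Holds x ρ a := by
  simp only [Holds, not, eval]
  omega

@[simp] theorem holds_lt : Holds x ρ (lt a b) ↔ a.eval x ρ < b.eval x ρ := by
  simp only [Holds, lt, eval]
  omega

@[simp] theorem holds_eq : Holds x ρ (eq a b) ↔ a.eval x ρ = b.eval x ρ := by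
  simp only [Holds, eq, not, eval]
  omega

@[simp] theorem holds_add : Holds x ρ (add a b) ↔ Holds x ρ a ∨ Holds x ρ b := by
  simp only [Holds, eval]
  omega

@[simp] theorem holds_mul : Holds x ρ (mul a b) ↔ Holds x ρ a ∧ Holds x ρ b := by
  simp [Holds, eval]

@[simp] theorem holds_bit : Holds x ρ (bit a) ↔ x[a.eval x ρ]? = some true := by
  simp [Holds, eval]

@[simp] theorem holds_sum {i : ℕ} :
    Holds x ρ (sum i b a) ↔ ∃ j < b.eval x ρ, Holds x (update ρ i j) a := by
  simp [Holds, eval]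

end

/-- The number of consecutive ones from position `p` on. -/
def ones (p : Expr) : Expr :=
  sum 0 len (not (sum 1 (add (var 0) one) (not (bit (add p (var 1))))))

theorem eval_not (x : List Bool) (ρ : ℕ → ℕ) (e : Expr) [Decidable (Holds x ρ e)] :
    (not e).eval x ρ = if Holds x ρ e then 0 else 1 := by
  by_cases h : Holds x ρ e
  · rw [if_pos h]
    simp only [not, eval, Holds] at *
    omega
  · rw [if_neg h]
    simp only [not, eval, Holds] at *
    omega

/-- The outer sum counts the `i` for which positions `q, …, q + i` all carry ones, that is, `i < m`.
Since `ones` binds variables 0 and 1 around `p`, the value of `p` must not depend on the assignment.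
-/
theorem eval_ones {x : List Bool} {p : Expr} {q m : ℕ} (hp : ∀ ρ, p.eval x ρ = q)
    (h : ∀ j < m, x[q + j]? = some true) (h' : x[q + m]? = some false) (ρ : ℕ → ℕ) :
    (ones p).eval x ρ = m := by
  classical
  have hm : m ≤ x.length := by
    have := (List.getElem?_eq_some_iff.1 h').1
    omega
  have key : ∀ i, Holds x (update ρ 0 i) (sum 1 (add (var 0) one) (not (bit (add p (var 1))))) ↔
      m ≤ i := by
    intro i
    simp only [holds_sum, holds_not, holds_bit, eval, hp, update_self]
    constructor
    · rintro ⟨j, hj, hx⟩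
      by_contra hi
      exact hx (h j (by omega))
    · intro hi
      exact ⟨m, by omega, by simp [h']⟩
  simp only [ones, eval]
  simp only [eval_not, key]
  rw [Finset.sum_ite]
  simp only [Finset.sum_const_zero, not_le, Finset.sum_const, smul_eq_mul, mul_one, zero_add]
  have : Finset.filter (fun i => i < m) (Finset.range x.length) = Finset.range m := by
    ext i
    simp
    omega
  rw [this, Finset.card_range]

def nE : Expr := ones zero

def kE : Expr := ones (add nE one)

theorem eval_nE (A : TSDomInstance) (ρ : ℕ → ℕ) : nE.eval A.encode ρ = A.n :=
  eval_ones (q := 0) (fun _ => rfl)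
    (fun j hj => by simpa [A.encode_eq] using getElem?_unaryPair_fst A.n A.k _ hj)
    (by simpa [A.encode_eq] using getElem?_unaryPair_fst_end A.n A.k _) ρ

theorem eval_kE (A : TSDomInstance) (ρ : ℕ → ℕ) : kE.eval A.encode ρ = A.k :=
  eval_ones (q := A.n + 1) (fun _ => by simp [eval, eval_nE])
    (fun j hj => by simpa [A.encode_eq] using getElem?_unaryPair_snd A.n A.k _ hj)
    (by simpa [A.encode_eq] using getElem?_unaryPair_snd_end A.n A.k _) ρ

end Expr

end LogSpace

/-! ### Recognizing vertices by their numbers -/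

namespace Reduction

open Function Vtx

theorem exists_lt_iff {n : ℕ} {P : ℕ → Prop} : (∃ j < n, P j) ↔ ∃ j : Fin n, P j := by
  simp [Fin.exists_iff]

theorem pos_injective {n : ℕ} : Injective (pos : Option (Fin n) → ℕ) := by
  intro u v h
  simpa [← finSuccEquivLast_symm_val, Fin.val_inj] using h

theorem pos_lt {n : ℕ} (u : Option (Fin n)) : pos u < n + 1 := by
  rw [← finSuccEquivLast_symm_val]
  exact Fin.is_lt _

theorem exists_lt_succ_iff {n : ℕ} {P : ℕ → Prop} :
    (∃ j < n + 1, P j) ↔ ∃ u : Option (Fin n), P (pos u) := by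
  constructor
  · rintro ⟨j, hj, h⟩
    rcases Nat.lt_succ_iff_lt_or_eq.1 hj with hj | rfl
    · exact ⟨some ⟨j, hj⟩, h⟩
    · exact ⟨none, h⟩
  · rintro ⟨u, h⟩
    exact ⟨_, pos_lt u, h⟩

section

variable {n k : ℕ} {w : Vtx n k}

theorem val_enc_inj {w w' : Vtx n k} : (enc n k w : ℕ) = enc n k w' ↔ w = w' := by
  rw [Fin.val_inj, EmbeddingLike.apply_eq_iff_eq]

theorem enc_eq_cp_iff {i : Fin k} {u : Option (Fin n)} :
    (enc n k w : ℕ) = i * (n + 1) + pos u ↔ w = cp i u := by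
  rw [← enc_cp, val_enc_inj]

theorem enc_eq_cp_some_iff {i : Fin k} {u : Fin n} :
    (enc n k w : ℕ) = i * (n + 1) + u ↔ w = cp i (some u) :=
  enc_eq_cp_iff (u := some u)

theorem enc_eq_cp_none_iff {i : Fin k} :
    (enc n k w : ℕ) = i * (n + 1) + n ↔ w = cp i none :=
  enc_eq_cp_iff (u := none)

theorem enc_eq_sw_false_iff : (enc n k w : ℕ) = k * (n + 1) ↔ w = sw false := by
  rw [← val_enc_inj, enc_sw, Bool.toNat_false, add_zero]

theorem enc_eq_sw_true_iff : (enc n k w : ℕ) = k * (n + 1) + 1 ↔ w = sw true := by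
  rw [← val_enc_inj, enc_sw, Bool.toNat_true]

theorem enc_eq_guardian_iff : (enc n k w : ℕ) = k * (n + 1) + 2 ↔ w = guardian := by
  rw [← val_enc_inj, enc_guardian]

theorem enc_eq_dv_iff {v : Fin n} : (enc n k w : ℕ) = k * (n + 1) + 3 + v ↔ w = dv v := by
  rw [← val_enc_inj, enc_dv]

theorem enc_eq_park_iff {i : Fin k} :
    (enc n k w : ℕ) = k * (n + 1) + 3 + n + i ↔ w = park i := by
  rw [← val_enc_inj, enc_park]

theorem enc_eq_sep_iff {i j : Fin k} {v : Option (Fin n)} : (enc n k w : ℕ) =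
    k * (n + 1) + 3 + n + k + (i * k + j) * (n + 1) + pos v ↔ w = sep i j v := by
  rw [← val_enc_inj, enc_sep]

theorem enc_lt_iff : (enc n k w : ℕ) < k * (n + 1) ↔ ∃ i u, w = cp i u := by
  constructor
  · intro h
    cases w with
    | cp i u => exact ⟨i, u, rfl⟩
    | sw b => simp only [enc_sw] at h; omega
    | guardian => simp only [enc_guardian] at h; omega
    | dv v => simp only [enc_dv] at h; omega
    | park i => simp only [enc_park] at h; omega
    | sep i j v => simp only [enc_sep] at h; omega
  · rintro ⟨i, u, rfl⟩
    have := Nat.mul_le_mul_right (n + 1) (Nat.succ_le_of_lt i.2)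
    have := pos_lt u
    rw [enc_cp]
    rw [Nat.succ_mul] at *
    omega

/-- Numbers beyond both switch places are exactly those of the last token set, which is how
`newPartE` recognizes it. -/
theorem lt_enc_iff : k * (n + 1) + 1 < (enc n k w : ℕ) ↔
    (¬ ∃ i u, w = cp i u) ∧ w ≠ sw false ∧ w ≠ sw true := by
  rw [← enc_lt_iff, Ne, Ne, ← enc_eq_sw_false_iff, ← enc_eq_sw_true_iff]
  omega

end

end Reduction

/-! ### Expressions and a program for the new instance -/

namespace LogSpace

open Function Reduction

namespace Expr

def const : ℕ → Expr
  | 0 => zero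
  | c + 1 => add (const c) one

theorem eval_const (x : List Bool) (ρ : ℕ → ℕ) (c : ℕ) : (const c).eval x ρ = c := by
  induction c with
  | zero => rfl
  | succ c ih => simp [const, eval, ih]

def n1E : Expr := add nE one

def baseE : Expr := mul kE n1E

/-- The number of the vertex `cp i u`. -/
def cpE (i u : Expr) : Expr := add (mul i n1E) u

def bitE (p : Expr) : Expr := bit (add (add (add nE kE) (const 2)) p)

def adjE (u v : Expr) : Expr := bitE (add (mul u nE) v)

def initE (v : Expr) : Expr := bitE (add (mul nE nE) v)

def finE (v : Expr) : Expr := bitE (add (add (mul nE nE) nE) v)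

def orAll : List Expr → Expr
  | [] => zero
  | e :: l => add e (orAll l)

/-- The relation `Reduction.rel` between the vertices with numbers `a` and `b`. -/
def relE (a b : Expr) : Expr := orAll [
  sum 2 kE (sum 4 nE (mul (eq a (cpE (var 2) (var 4)))
    (add (sum 5 nE (mul (eq b (cpE (var 2) (var 5))) (adjE (var 4) (var 5))))
      (mul (eq b (cpE (var 2) nE)) (finE (var 4)))))),
  mul (add (eq a baseE) (eq a (add baseE one))) (lt b baseE),
  mul (eq a baseE) (eq b (add baseE one)),
  sum 5 nE (mul (eq a (add (add baseE (const 3)) (var 5)))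
    (add (eq b (add baseE one)) (sum 2 kE (sum 4 nE (mul (eq b (cpE (var 2) (var 4)))
      (add (eq (var 4) (var 5)) (adjE (var 4) (var 5)))))))),
  sum 2 kE (mul (eq a (add (add (add baseE (const 3)) nE) (var 2)))
    (add (eq b baseE) (add (eq b (cpE (var 2) nE))
      (sum 4 nE (mul (eq b (cpE (var 2) (var 4))) (finE (var 4))))))),
  sum 2 kE (sum 3 kE (sum 5 n1E (mul (eq a (add (add (add (add (add baseE (const 3)) nE) kE)
      (mul (add (mul (var 2) kE) (var 3)) n1E)) (var 5)))
    (add (eq b (add baseE one)) (add (mul (eq b baseE) (mul (eq (var 2) (var 3)) (lt (var 5) nE)))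
      (sum 4 n1E (mul (not (eq (var 4) (var 5)))
        (add (eq b (cpE (var 2) (var 4))) (eq b (cpE (var 3) (var 4)))))))))))]

def newAdjE : Expr :=
  mul (not (eq (var 0) (var 1))) (add (relE (var 0) (var 1)) (relE (var 1) (var 0)))

/-- The inner sum over variable 6 is the rank of the vertex in `A.Dinit`, hence the index of the
token standing on it. -/
def newInitE : Expr := orAll [eq (var 0) baseE, eq (var 0) (add baseE (const 2)),
  sum 4 nE (mul (initE (var 4)) (eq (var 0) (cpE (sum 6 (var 4) (initE (var 6))) (var 4))))]

def newFinE : Expr := orAll [eq (var 0) (add baseE one), eq (var 0) (add baseE (const 2)),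
  sum 2 kE (eq (var 0) (cpE (var 2) nE))]

def newPartE : Expr := orAll [
  sum 2 kE (sum 4 n1E (mul (eq (var 0) (cpE (var 2) (var 4))) (eq (var 1) (var 2)))),
  mul (eq (var 1) kE) (add (eq (var 0) baseE) (eq (var 0) (add baseE one))),
  mul (eq (var 1) (add kE one)) (lt (add baseE one) (var 0))]

def sizeE : Expr := add baseE (add (const 2) (add one (add nE (add kE (mul (mul kE kE) n1E)))))

variable (A : TSDomInstance) (ρ : ℕ → ℕ)

theorem eval_sizeE : sizeE.eval A.encode ρ = size A.n A.k := by
  simp only [sizeE, baseE, n1E, eval, eval_const, eval_nE, eval_kE, size]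

/-- The variables 0 and 1 are kept for the two vertices, and the sums written out in `relE` bind
only 2 to 5. Inside `nE` and `kE` the variables 0 and 1 are bound as well, but their values are the
same under every assignment. -/
theorem holds_relE {a b : ℕ} (ha : a < 2) (hb : b < 2) {w w' : Vtx A.n A.k}
    (hw : ρ a = enc A.n A.k w) (hw' : ρ b = enc A.n A.k w') :
    Holds A.encode ρ (relE (var a) (var b)) ↔ rel A w w' := by
  have h : ∀ c, 2 ≤ c → a ≠ c ∧ b ≠ c := fun c hc => ⟨by omega, by omega⟩
  have h2 := h 2 (by norm_num)
  have h3 := h 3 (by norm_num)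
  have h4 := h 4 (by norm_num)
  have h5 := h 5 (by norm_num)
  have hpos : ∀ v : Option (Fin A.n), pos v < A.n ↔ v ≠ none := by
    rintro (_ | v) <;> simp [pos]
  simp only [relE, orAll, holds_add, holds_mul, holds_sum, holds_eq, holds_lt, holds_not, holds_bit,
    adjE, finE, bitE, cpE, baseE, n1E, eval, eval_nE, eval_kE, eval_const, update_apply,
    hw, hw', h2.1, h2.2, h3.1, h3.2, h4.1, h4.2, h5.1, h5.2, if_false, holds_zero,
    show (4 : ℕ) ≠ 5 by decide, show (2 : ℕ) ≠ 5 by decide, show (2 : ℕ) ≠ 4 by decide,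
    show (2 : ℕ) ≠ 3 by decide, show (3 : ℕ) ≠ 5 by decide, show (3 : ℕ) ≠ 4 by decide,
    show (5 : ℕ) ≠ 4 by decide, if_true, exists_lt_succ_iff, or_false]
  simp only [exists_lt_iff, enc_eq_cp_iff, enc_eq_cp_some_iff, enc_eq_cp_none_iff,
    enc_eq_sw_false_iff, enc_eq_sw_true_iff, enc_eq_dv_iff, enc_eq_park_iff, enc_eq_sep_iff,
    enc_lt_iff, TSDomInstance.getElem?_encode_adj, TSDomInstance.getElem?_encode_fin, Fin.val_inj,
    pos_injective.eq_iff, hpos]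
  rcases w with ⟨i, u⟩ | b | _ | v | i | ⟨i, j, v⟩ <;>
    rcases w' with ⟨i', u'⟩ | b' | _ | v' | i' | ⟨i', j', v'⟩ <;>
    simp [rel]
  · cases u <;> cases u' <;> simp [Arc, eq_comm]
  · simp [Fin.val_inj, TSDomInstance.getElem?_encode_adj]
  · cases u' <;> simp
  · constructor
    · rintro ⟨u, hu, ⟨rfl, rfl⟩ | ⟨rfl, rfl⟩⟩ <;> simp [hu]
    · rintro ⟨rfl | rfl, hu⟩ <;> exact ⟨u', hu, by simp⟩
  · cases b' <;> simp

theorem holds_newAdjE {w w' : Vtx A.n A.k} (hw : ρ 0 = enc A.n A.k w)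
    (hw' : ρ 1 = enc A.n A.k w') : Holds A.encode ρ newAdjE ↔ (Reduction.graph A).Adj w w' := by
  rw [Reduction.graph, SimpleGraph.fromRel_adj, newAdjE, holds_mul, holds_not, holds_eq, holds_add,
    holds_relE A ρ (by norm_num) (by norm_num) hw hw',
    holds_relE A ρ (by norm_num) (by norm_num) hw' hw]
  simp only [eval, hw, hw', val_enc_inj, ne_eq]

theorem sum_initE (i : Fin A.k) :
    (∑ j ∈ Finset.range (A.Dinit.orderEmbOfFin A.init_card i),
      (initE (var 6)).eval A.encode (update ρ 6 j)) = i := by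
  simp only [initE, bitE, eval, eval_nE, eval_kE, eval_const, update_self]
  rw [Finset.sum_boole, Nat.cast_id]
  -- The elements of `A.Dinit` below the `i`-th one are the images of the indices below `i`, so
  -- their number is `i`.
  have : Finset.filter (fun j => A.encode[A.n + A.k + 2 + (A.n * A.n + j)]? = some true)
      (Finset.range (A.Dinit.orderEmbOfFin A.init_card i)) =
      (Finset.Iio i).map ((A.Dinit.orderEmbOfFin A.init_card).toEmbedding.trans
        Fin.valEmbedding) := by
    ext j
    simp only [Finset.mem_filter, Finset.mem_range, Finset.mem_map, Finset.mem_Iio,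
      Embedding.trans_apply, RelEmbedding.coe_toEmbedding, Fin.valEmbedding_apply]
    constructor
    · rintro ⟨hj, h⟩
      lift j to Fin A.n using hj.trans (Fin.is_lt _)
      rw [A.getElem?_encode_init, ← Finset.mem_coe (s := A.Dinit),
        ← Finset.range_orderEmbOfFin _ A.init_card] at h
      obtain ⟨l, rfl⟩ := h
      exact ⟨l, by simpa using hj, rfl⟩
    · rintro ⟨l, hl, rfl⟩
      rw [A.getElem?_encode_init]
      exact ⟨by simpa using hl, Finset.orderEmbOfFin_mem _ _ _⟩
  rw [this, Finset.card_map, Fin.card_Iio]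

theorem holds_newInitE {w : Vtx A.n A.k} (hw : ρ 0 = enc A.n A.k w) :
    Holds A.encode ρ newInitE ↔ InConf (initPos A) false w := by
  have hrank : ∀ i, (sum 6 (var 4) (initE (var 6))).eval A.encode
      (update ρ 4 (A.Dinit.orderEmbOfFin A.init_card i)) = i := by
    intro i
    simpa [eval] using sum_initE A (update ρ 4 (A.Dinit.orderEmbOfFin A.init_card i)) i
  have hex : (∃ j < A.n, Holds A.encode (update ρ 4 j) (mul (initE (var 4))
      (eq (var 0) (cpE (sum 6 (var 4) (initE (var 6))) (var 4))))) ↔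
      ∃ i, w = Vtx.cp i (initPos A i) := by
    rw [exists_lt_iff]
    simp only [holds_mul, holds_eq]
    have hinit : ∀ j : Fin A.n, Holds A.encode (update ρ 4 (j : ℕ)) (initE (var 4)) ↔
        j ∈ Set.range (A.Dinit.orderEmbOfFin A.init_card) := by
      intro j
      rw [initE, bitE, holds_bit]
      simp only [eval, eval_nE, eval_kE, eval_const, update_self, A.getElem?_encode_init]
      rw [Finset.range_orderEmbOfFin, Finset.mem_coe]
    simp only [hinit]
    rw [Set.exists_range_iff]
    refine exists_congr fun i => ?_
    rw [cpE, n1E, initPos]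
    simp only [eval, eval_nE] at hrank ⊢
    rw [hrank i, update_self, update_of_ne (by norm_num), hw, enc_eq_cp_some_iff]
  simp only [newInitE, orAll, holds_add, holds_sum, eval_nE, hex]
  simp only [holds_eq, baseE, n1E, eval, eval_nE, eval_kE, eval_const, hw, holds_zero,
    enc_eq_sw_false_iff, enc_eq_guardian_iff]
  cases w <;> simp [InConf, eq_comm]

theorem holds_newFinE {w : Vtx A.n A.k} (hw : ρ 0 = enc A.n A.k w) :
    Holds A.encode ρ newFinE ↔ InConf (fun _ => none) true w := by
  simp only [newFinE, orAll, holds_add, holds_sum, holds_eq, cpE, baseE, n1E, eval, eval_nE,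
    eval_kE, eval_const, update_self, update_of_ne (show (0 : ℕ) ≠ 2 by decide), hw, holds_zero,
    enc_eq_sw_true_iff, enc_eq_guardian_iff, exists_lt_iff, enc_eq_cp_none_iff]
  cases w <;> simp [InConf, eq_comm]

theorem holds_newPartE {w : Vtx A.n A.k} (hw : ρ 0 = enc A.n A.k w) {t : Fin (A.k + 2)}
    (ht : ρ 1 = t) : Holds A.encode ρ newPartE ↔ part w = t := by
  simp only [newPartE, orAll, holds_add, holds_mul, holds_sum, holds_eq, holds_lt, cpE, baseE, n1E,
    eval, eval_nE, eval_kE, update_apply, hw, ht, holds_zero, or_false,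
    show (0 : ℕ) ≠ 2 by decide, show (0 : ℕ) ≠ 4 by decide, show (1 : ℕ) ≠ 2 by decide,
    show (1 : ℕ) ≠ 4 by decide, show (2 : ℕ) ≠ 4 by decide, if_true, if_false,
    exists_lt_succ_iff]
  simp only [exists_lt_iff, enc_eq_cp_iff, enc_eq_sw_false_iff, enc_eq_sw_true_iff, lt_enc_iff]
  cases w <;> simp [part, Fin.ext_iff, eq_comm]
  exact ⟨fun ⟨j, h, h'⟩ => h'.trans h.symm, fun h => ⟨_, rfl, h⟩⟩

end Expr

theorem flatMap_range_singleton {n : ℕ} (f : ℕ → Bool) (g : Fin n → Bool)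
    (h : ∀ a : Fin n, f a = g a) :
    ((List.range n).flatMap fun a => [f a]) = (List.finRange n).map g := by
  rw [← List.map_coe_finRange_eq_range, List.flatMap_map, ← List.map_eq_flatMap]
  exact List.map_congr_left fun a _ => h a

theorem flatMap_range_range_singleton {n m : ℕ} (f : ℕ → ℕ → Bool) (g : Fin n × Fin m → Bool)
    (h : ∀ (a : Fin n) (b : Fin m), f a b = g (a, b)) :
    ((List.range n).flatMap fun a => (List.range m).flatMap fun b => [f a b]) =
      (List.finRange n ×ˢ List.finRange m).map g := by
  change _ = ((List.finRange n).flatMap fun a => (List.finRange m).map (Prod.mk a)).map g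
  rw [← List.map_coe_finRange_eq_range (n := n), List.flatMap_map, List.map_flatMap]
  refine List.flatMap_congr fun a _ => ?_
  rw [flatMap_range_singleton (f a) (fun b => g (a, b)) (h a), List.map_map]
  rfl

theorem flatMap_range_true (n : ℕ) :
    ((List.range n).flatMap fun _ => [true]) = List.replicate n true := by
  rw [← List.map_eq_flatMap, List.map_const', List.length_range]

namespace Prog

open LogSpace.Expr

/-- The program that writes the encoding of the new instance. -/
def reduction : Prog :=
  seq (.forEach 0 sizeE (emit one)) <| seq (emit zero) <|
  seq (.forEach 0 (add kE (const 2)) (emit one)) <| seq (emit zero) <|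
  seq (.forEach 0 sizeE (.forEach 1 sizeE (emit newAdjE))) <|
  seq (.forEach 0 sizeE (emit newInitE)) <| seq (.forEach 0 sizeE (emit newFinE)) <|
  .forEach 0 sizeE (.forEach 1 (add kE (const 2)) (emit newPartE))

theorem denote_reduction (A : TSDomInstance) (ρ : ℕ → ℕ) :
    reduction.denote A.encode ρ = (newInstance A).encode := by
  have hz : zero.eval A.encode ρ = 0 := rfl
  simp only [reduction, denote, eval_sizeE, Expr.eval, eval_kE, eval_const, hz, ne_eq, one_ne_zero,
    not_false_eq_true, not_true_eq_false, decide_true, decide_false, flatMap_range_true]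
  rw [PartTSDomInstance.encode, TSDomInstance.encode_eq (newInstance A).toTSDomInstance, unaryPair]
  simp only [List.append_assoc, List.cons_append, List.nil_append]
  congr 1
  congr 1
  congr 1
  congr 1
  congr 1
  · refine flatMap_range_range_singleton _ _ fun a b => decide_eq_decide.2 ?_
    exact holds_newAdjE A _ (w := (enc A.n A.k).symm a) (w' := (enc A.n A.k).symm b)
      (by simp) (by simp)
  congr 1
  · refine flatMap_range_singleton _ _ fun a => decide_eq_decide.2 ?_
    refine (holds_newInitE A _ (w := (enc A.n A.k).symm a) (by simp)).trans
      ((enc_mem_conf A (c := (initPos A, false))).symm.trans ?_)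
    rw [Equiv.apply_symm_apply]
    rfl
  congr 1
  · refine flatMap_range_singleton _ _ fun a => decide_eq_decide.2 ?_
    refine (holds_newFinE A _ (w := (enc A.n A.k).symm a) (by simp)).trans
      ((enc_mem_conf A (c := (fun _ => none, true))).symm.trans ?_)
    rw [Equiv.apply_symm_apply]
    rfl
  · refine flatMap_range_range_singleton _ _ fun a b => decide_eq_decide.2 ?_
    exact holds_newPartE A _ (w := (enc A.n A.k).symm a) (by simp) (by simp)

end Prog

end LogSpace

theorem isPLReduction_newInstance :
    IsPLReduction TSDomReconf PartTSDomReconf Reduction.newInstance := by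
  refine ⟨fun A => Reduction.isYes_newInstance_iff A, ⟨fun k => k + 2, ?_, fun A => le_rfl⟩, ?_⟩
  · exact (Primrec.nat_add.comp Primrec.id (Primrec.const 2)).to_comp
  · obtain ⟨M, c, hM⟩ := LogSpace.Prog.exists_transducer LogSpace.Prog.reduction
    -- Space logarithmic in the input length suffices by itself, so the parameter contributes
    -- nothing.
    refine ⟨M, fun _ => 0, c, Computable.const 0, fun (A : TSDomInstance) => ?_⟩
    have := hM A.encode
    rw [LogSpace.Prog.denote_reduction A] at this
    change M.OutputsInSpace A.encode (Reduction.newInstance A).encode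
      (c * (0 + Nat.log 2 A.encode.length + 1))
    rwa [zero_add]

theorem mainTheorem7 :
    ∃ f : TSDomInstance → PartTSDomInstance,
      IsPLReduction TSDomReconf PartTSDomReconf f ∧
      ∀ A : TSDomInstance,
        (f A).k = A.k + 2 ∧
        (∀ ℓ : ℕ, (∃ m ≤ ℓ, A.AdmitsLength m) ↔
          ∃ m ≤ ℓ + A.k + 1, (f A).AdmitsLength m) ∧
        (∀ ℓ : ℕ, A.AdmitsLength ℓ → (f A).AdmitsLength (ℓ + A.k + 1)) ∧
        (∀ m : ℕ, (f A).AdmitsLength m → ∃ ℓ : ℕ, ℓ + A.k + 1 ≤ m ∧ A.AdmitsLength ℓ) := by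
  refine ⟨Reduction.newInstance, isPLReduction_newInstance, fun A => ⟨rfl, fun ℓ => ⟨?_, ?_⟩,
    fun ℓ => Reduction.newInstance_admitsLength A,
    fun m => Reduction.admitsLength_of_newInstance A⟩⟩
  · rintro ⟨m, hm, h⟩
    exact ⟨m + A.k + 1, by omega, Reduction.newInstance_admitsLength A h⟩
  · rintro ⟨m, hm, h⟩
    obtain ⟨ℓ', hl, h'⟩ := Reduction.admitsLength_of_newInstance A h
    exact ⟨ℓ', by omega, h'⟩
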